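/- Let $D\ge 1$, let $\Omega\subset\mathbb R^D$ (flat $D$-dimensional spacetime with coordinates $x^\mu$) be compact with smooth boundary $\partial\Omega$, locally on one side of its boundary, and let $n_\mu$ be the components of its outward pointing unit normal and $d^{D-1}x$ the area element of $\partial\Omega$, both taken with respect to the Euclidean structure of the coordinates. Let fields take values in a finite-dimensional real vector space $F$ ($F=\mathbb R$ for a real scalar field, $F=\mathbb C$ for a complex one), and let $\mathcal L(x,\phi,\partial\phi)$ be a smooth real-valued Lagrangian density, defined for $x$ in a neighbourhood of $\Omega$ and all values of $\phi\in F$ and $\partial\phi=(\partial_\mu\phi)_\mu\in F^D$. Denote by $\frac{\partial\mathcal L}{\partial\phi}$ and $\frac{\partial\mathcal L}{\partial(\partial_\mu\phi)}$ its derivatives in these arguments (linear forms on $F$; ordinary partial derivatives if $F=\mathbb R$), evaluated at $(x,\phi(x),\partial\phi(x))$. Let $\phi$ be smooth on a neighbourhood of $\Omega$ and satisfy on $\Omega$ the Euler–Lagrange equation $$\frac{\partial\mathcal L}{\partial\phi}-\partial_\mu\frac{\partial\mathcal L}{\partial(\partial_\mu\phi)}=0$$ (summation over $\mu$), and let $(\varepsilon,x)\mapsto\phi_\varepsilon(x)$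 be an $F$-valued function which is smooth for $\varepsilon$ in a neighbourhood of $0$ and $x$ in a neighbourhood of $\Omega$, with $\phi_0=\phi$ on $\Omega$. Then the two integrands below are integrable, on $\partial\Omega$ and on $\Omega$ respectively, and $$\oint_{\partial\Omega} d^{D-1}x\; n_\mu\,\frac{\partial\mathcal L}{\partial(\partial_\mu\phi)}\,\frac{\partial\phi_\varepsilon}{\partial\varepsilon}\bigg|_{\varepsilon=0}\;-\;\int_\Omega d^Dx\;\frac{\partial}{\partial\varepsilon}\mathcal L(x,\phi_\varepsilon,\partial\phi_\varepsilon)\bigg|_{\varepsilon=0}\;=\;0 .$$ In particular this expression (the nonlocal constant associated to $\phi_\varepsilon$) is constant: it depends neither on a point of $\Omega$ nor on $\Omega$, $\phi$ or $\phi_\varepsilon$. -/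

import Mathlib

open Set Filter Topology MeasureTheory
open scoped ContDiff

namespace FieldTheory

/-- Flat spacetime of dimension `D = d + 1`, identified with `ℝ^D` by global coordinates `x^μ`.
The Euclidean structure of the coordinate space serves only to write the covector-valued surface
element of a hypersurface as `n_μ dσ` (unit conormal times area). -/
abbrev Spacetime (d : ℕ) : Type := EuclideanSpace ℝ (Fin (d + 1))

/-- The partial derivative `∂_μ f` with respect to the spacetime coordinate `x^μ`. -/
noncomputable def partialDeriv {d : ℕ} {G : Type*} [NormedAddCommGroup G] [NormedSpace ℝ G]
    (μ : Fin (d + 1)) (f : Spacetime d → G) (x : Spacetime d) : G :=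
  fderiv ℝ f x (EuclideanSpace.single μ (1 : ℝ))

/-! ### Domains with smooth boundary -/

/-- `ρ` is a smooth local defining function of `Ω` at the point `x` of its boundary: near `x` the
set `Ω` is `{ρ ≤ 0}`, and `ρ` vanishes at `x` with non-zero gradient. -/
structure IsDefiningFunctionAt {d : ℕ} (Ω : Set (Spacetime d)) (x : Spacetime d)
    (ρ : Spacetime d → ℝ) : Prop where
  smooth : ∀ᶠ y in 𝓝 x, ContDiffAt ℝ ∞ ρ y
  eq_zero : ρ x = 0
  gradient_ne_zero : gradient ρ x ≠ 0
  mem_iff : ∀ᶠ y in 𝓝 x, (y ∈ Ω ↔ ρ y ≤ 0)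

/-- The topological boundary of `Ω` is smooth, and `Ω` lies locally on one side of it. -/
def HasSmoothBoundary {d : ℕ} (Ω : Set (Spacetime d)) : Prop :=
  ∀ x ∈ frontier Ω, ∃ ρ : Spacetime d → ℝ, IsDefiningFunctionAt Ω x ρ

open Classical in
/-- The outward pointing unit normal `n` of `Ω` at a boundary point: `∇ρ / ‖∇ρ‖` for any local
defining function `ρ` (see `outwardNormal_eq` for the independence of the choice). Its components
`n_μ` are `outwardNormal Ω x μ`. -/
noncomputable def outwardNormal {d : ℕ} (Ω : Set (Spacetime d)) (x : Spacetime d) : Spacetime d :=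
  if h : ∃ ρ : Spacetime d → ℝ, IsDefiningFunctionAt Ω x ρ then
    ‖gradient h.choose x‖⁻¹ • gradient h.choose x
  else 0

/-- Moving from `x` in a direction of positive derivative, a function vanishing at `x` becomes
positive. -/
theorem eventually_pos_of_inner_gradient_pos {d : ℕ} {ρ : Spacetime d → ℝ} {x v : Spacetime d}
    (hd : DifferentiableAt ℝ ρ x) (h0 : ρ x = 0) (hv : 0 < inner ℝ (gradient ρ x) v) :
    ∀ᶠ t : ℝ in 𝓝[>] 0, 0 < ρ (x + t • v) := by
  have hline : HasDerivAt (fun t : ℝ => x + t • v) v 0 := by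
    simpa using ((hasDerivAt_id (0 : ℝ)).smul_const v).const_add x
  have hρ : HasFDerivAt ρ (fderiv ℝ ρ x) (x + (0 : ℝ) • v) := by
    simpa using hd.hasFDerivAt
  have hcomp : HasDerivAt (fun t : ℝ => ρ (x + t • v)) (inner ℝ (gradient ρ x) v) 0 := by
    have := hρ.comp_hasDerivAt (0 : ℝ) hline
    rw [inner_gradient_left]
    exact this
  have hslope := hasDerivAt_iff_tendsto_slope.1 hcomp
  have hev := (hslope.mono_left (nhdsWithin_mono _ (fun t (ht : (0 : ℝ) < t) => ht.ne'))).eventually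
    (lt_mem_nhds hv)
  filter_upwards [hev, self_mem_nhdsWithin] with t ht ht0
  have ht0' : (0 : ℝ) < t := ht0
  rw [slope_def_field] at ht
  simp only [zero_smul, add_zero, h0, sub_zero] at ht
  by_contra hneg
  exact absurd ht (not_lt.2 (div_nonpos_of_nonpos_of_nonneg (not_lt.1 hneg) ht0'.le))

/-- The normalized gradient does not depend on the local defining function. -/
theorem IsDefiningFunctionAt.unitNormal_unique {d : ℕ} {Ω : Set (Spacetime d)} {x : Spacetime d}
    {ρ₁ ρ₂ : Spacetime d → ℝ} (h₁ : IsDefiningFunctionAt Ω x ρ₁)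
    (h₂ : IsDefiningFunctionAt Ω x ρ₂) :
    ‖gradient ρ₁ x‖⁻¹ • gradient ρ₁ x = ‖gradient ρ₂ x‖⁻¹ • gradient ρ₂ x := by
  by_contra hne
  set g₁ := gradient ρ₁ x with hg₁
  set g₂ := gradient ρ₂ x with hg₂
  have p₁ : 0 < ‖g₁‖ := norm_pos_iff.2 h₁.gradient_ne_zero
  have p₂ : 0 < ‖g₂‖ := norm_pos_iff.2 h₂.gradient_ne_zero
  set u₁ := ‖g₁‖⁻¹ • g₁ with hu₁
  set u₂ := ‖g₂‖⁻¹ • g₂ with hu₂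
  have n₁ : ‖u₁‖ = 1 := by rw [hu₁, norm_smul, norm_inv, norm_norm, inv_mul_cancel₀ p₁.ne']
  have n₂ : ‖u₂‖ = 1 := by rw [hu₂, norm_smul, norm_inv, norm_norm, inv_mul_cancel₀ p₂.ne']
  have e₁ : g₁ = ‖g₁‖ • u₁ := by rw [hu₁, smul_smul, mul_inv_cancel₀ p₁.ne', one_smul]
  have e₂ : g₂ = ‖g₂‖ • u₂ := by rw [hu₂, smul_smul, mul_inv_cancel₀ p₂.ne', one_smul]
  have hlt : inner ℝ u₁ u₂ < 1 := (inner_lt_one_iff_real_of_norm_eq_one n₁ n₂).2 hne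
  have i₁ : inner ℝ g₁ (u₂ - u₁) < 0 := by
    rw [e₁, real_inner_smul_left, inner_sub_right, real_inner_self_eq_norm_sq, n₁]
    nlinarith
  have i₂ : 0 < inner ℝ g₂ (u₂ - u₁) := by
    rw [e₂, real_inner_smul_left, inner_sub_right, real_inner_self_eq_norm_sq, n₂,
      real_inner_comm]
    nlinarith
  have d₁ : DifferentiableAt ℝ ρ₁ x := h₁.smooth.self_of_nhds.differentiableAt (by simp)
  have d₂ : DifferentiableAt ℝ ρ₂ x := h₂.smooth.self_of_nhds.differentiableAt (by simp)
  have q₂ := eventually_pos_of_inner_gradient_pos d₂ h₂.eq_zero i₂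
  have hg : gradient (fun y => -ρ₁ y) x = -g₁ := by
    rw [hg₁]; simp [gradient, fderiv_fun_neg]
  have q₁ := eventually_pos_of_inner_gradient_pos (ρ := fun y => -ρ₁ y) (v := u₂ - u₁) d₁.neg
    (by simp [h₁.eq_zero]) (by rw [hg, inner_neg_left]; linarith)
  have hc : Tendsto (fun t : ℝ => x + t • (u₂ - u₁)) (𝓝[>] 0) (𝓝 x) := by
    have : Continuous (fun t : ℝ => x + t • (u₂ - u₁)) := by fun_prop
    simpa using (this.tendsto 0).mono_left nhdsWithin_le_nhds
  obtain ⟨t, a, b, m₁, m₂⟩ := (q₁.and (q₂.and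
    ((hc.eventually h₁.mem_iff).and (hc.eventually h₂.mem_iff)))).exists
  have := m₂.1 (m₁.2 (by linarith))
  linarith

/-- The outward unit normal can be computed from any local defining function. -/
theorem outwardNormal_eq {d : ℕ} {Ω : Set (Spacetime d)} {x : Spacetime d}
    {ρ : Spacetime d → ℝ} (h : IsDefiningFunctionAt Ω x ρ) :
    outwardNormal Ω x = ‖gradient ρ x‖⁻¹ • gradient ρ x := by
  have hex : ∃ ρ : Spacetime d → ℝ, IsDefiningFunctionAt Ω x ρ := ⟨ρ, h⟩
  rw [outwardNormal, dif_pos hex]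
  exact hex.choose_spec.unitNormal_unique h

/-! ### Lagrangian field theory

Fields take values in a finite-dimensional real vector space `F`; `F = ℝ` is a real scalar field,
`F = ℂ` a complex one. A Lagrangian density is a function of `(x, φ, (∂_μ φ)_μ)`. -/

section

variable {d : ℕ} {F : Type*} [NormedAddCommGroup F] [NormedSpace ℝ F]

/-- `L(x, φ, ∂φ)` is smooth for `x` in a neighbourhood of `Ω` and all values of `φ` and `∂φ`. -/
def IsLagrangianDensity (Ω : Set (Spacetime d))
    (L : Spacetime d × F × (Fin (d + 1) → F) → ℝ) : Prop :=
  ∃ V : Set (Spacetime d), IsOpen V ∧ Ω ⊆ V ∧ ContDiffOn ℝ ∞ L (V ×ˢ univ)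

/-- The point `(x, φ(x), (∂_μ φ(x))_μ)` at which the Lagrangian density is evaluated. -/
noncomputable def jet (φ : Spacetime d → F) (x : Spacetime d) :
    Spacetime d × F × (Fin (d + 1) → F) :=
  (x, φ x, fun μ => partialDeriv μ φ x)

/-- `δL/δφ` along `φ`: the derivative of `L(x, u, p)` in `u` at `u = φ(x)`, `p = ∂φ(x)`, a linear
form on `F` (a number when `F = ℝ`). -/
noncomputable def fieldDeriv (L : Spacetime d × F × (Fin (d + 1) → F) → ℝ) (φ : Spacetime d → F)
    (x : Spacetime d) : F →L[ℝ] ℝ :=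
  fderiv ℝ (fun u : F => L (x, u, fun μ => partialDeriv μ φ x)) (φ x)

/-- `δL/δ(∂_μ φ)` along `φ`: the derivative of `L(x, u, p)` in the single argument `p_μ` at
`u = φ(x)`, `p = ∂φ(x)`. -/
noncomputable def momentum (L : Spacetime d × F × (Fin (d + 1) → F) → ℝ) (φ : Spacetime d → F)
    (μ : Fin (d + 1)) (x : Spacetime d) : F →L[ℝ] ℝ :=
  fderiv ℝ (fun v : F => L (x, φ x, Function.update (fun ν => partialDeriv ν φ x) μ v))
    (partialDeriv μ φ x)

/-- `φ` is a smooth solution on `Ω` of `δL/δφ - ∂_μ (δL/δ(∂_μ φ)) = 0`. -/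
def IsSolution (Ω : Set (Spacetime d)) (L : Spacetime d × F × (Fin (d + 1) → F) → ℝ)
    (φ : Spacetime d → F) : Prop :=
  (∃ U : Set (Spacetime d), IsOpen U ∧ Ω ⊆ U ∧ ContDiffOn ℝ ∞ φ U) ∧
    ∀ x ∈ Ω, fieldDeriv L φ x - ∑ μ, partialDeriv μ (momentum L φ μ) x = 0

/-- `(ε, x) ↦ φ_ε(x)` is a perturbed field associated to `φ`: it is smooth for `ε` near `0` and `x`
in a neighbourhood of `Ω`, and `φ_0 = φ` on `Ω`. -/
def IsPerturbedField (Ω : Set (Spacetime d)) (φ : Spacetime d → F)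
    (Φ : ℝ → Spacetime d → F) : Prop :=
  (∃ δ > 0, ∃ U : Set (Spacetime d), IsOpen U ∧ Ω ⊆ U ∧
    ContDiffOn ℝ ∞ (fun q : ℝ × Spacetime d => Φ q.1 q.2) (Ioo (-δ) δ ×ˢ U)) ∧
    ∀ x ∈ Ω, Φ 0 x = φ x

/-- The boundary flux density `n_μ (δL/δ(∂_μ φ)) ∂φ_ε/∂ε|₀`. -/
noncomputable def fluxDensity (Ω : Set (Spacetime d))
    (L : Spacetime d × F × (Fin (d + 1) → F) → ℝ) (φ : Spacetime d → F)
    (Φ : ℝ → Spacetime d → F) (x : Spacetime d) : ℝ :=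
  ∑ μ, outwardNormal Ω x μ * momentum L φ μ x (deriv (fun ε => Φ ε x) 0)

/-- The variation density `∂/∂ε L(x, φ_ε, ∂φ_ε)|₀`. -/
noncomputable def variationDensity (L : Spacetime d × F × (Fin (d + 1) → F) → ℝ)
    (Φ : ℝ → Spacetime d → F) (x : Spacetime d) : ℝ :=
  deriv (fun ε => L (jet (Φ ε) x)) 0

/-- The nonlocal constant associated to a perturbed field. The surface integral is taken against
the `(D - 1)`-dimensional area measure, i.e. the normalized Hausdorff measure. -/
noncomputable def nonlocalConstant (Ω : Set (Spacetime d))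
    (L : Spacetime d × F × (Fin (d + 1) → F) → ℝ) (φ : Spacetime d → F)
    (Φ : ℝ → Spacetime d → F) : ℝ :=
  (∫ x in frontier Ω, fluxDensity Ω L φ Φ x ∂(Measure.euclideanHausdorffMeasure d)) -
    ∫ x in Ω, variationDensity L Φ x

end

end FieldTheory

namespace FieldTheory

open Module (finrank)
open scoped ENNReal NNReal

/-! ### Hausdorff measure and oblique projections -/

/-- Two measures compare if they compare locally up to factors arbitrarily close to `1`. -/
theorem measure_le_of_locally_le_mul {X : Type*} [TopologicalSpace X] [SecondCountableTopology X]
    [MeasurableSpace X] [OpensMeasurableSpace X] {μ ν : Measure X}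
    (h : ∀ c : ℝ≥0, 1 < c → ∀ x, ∃ U ∈ 𝓝 x, ∀ A ⊆ U, MeasurableSet A → μ A ≤ c * ν A) :
    μ ≤ ν := by
  refine Measure.le_iff.2 fun A hA => ?_
  have key : ∀ c : ℝ≥0, 1 < c → μ A ≤ c * ν A := by
    intro c hc
    choose U hU hUA using h c hc
    obtain ⟨s, hs, hsU⟩ := TopologicalSpace.countable_cover_nhds
      (fun x => isOpen_interior.mem_nhds (mem_interior_iff_mem_nhds.2 (hU x)))
    rcases s.eq_empty_or_nonempty with rfl | hne
    · have : A = ∅ := by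
        rw [← subset_empty_iff]
        refine (subset_univ A).trans ?_
        rw [← hsU]; simp
      simp [this]
    obtain ⟨g, rfl⟩ := hs.exists_eq_range hne
    set V : ℕ → Set X := fun i => interior (U (g i)) with hV
    have hVm : ∀ i, MeasurableSet (V i) := fun i => isOpen_interior.measurableSet
    have hA' : A = ⋃ i, A ∩ disjointed V i := by
      rw [← inter_iUnion, iUnion_disjointed]
      have : ⋃ i, V i = univ := by simpa [hV] using hsU
      rw [this, inter_univ]
    have hd : Pairwise (Function.onFun Disjoint fun i => A ∩ disjointed V i) := fun i j hij =>
      ((disjoint_disjointed V) hij).mono inter_subset_right inter_subset_right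
    have hm : ∀ i, MeasurableSet (A ∩ disjointed V i) := fun i =>
      hA.inter (MeasurableSet.disjointed hVm i)
    rw [hA', measure_iUnion hd hm, measure_iUnion hd hm, ← ENNReal.tsum_mul_left]
    refine ENNReal.tsum_le_tsum fun i => hUA (g i) _ ?_ (hm i)
    exact inter_subset_right.trans ((disjointed_subset V i).trans interior_subset)
  rcases eq_or_ne (ν A) ∞ with htop | htop
  · simp [htop]
  have ht : Tendsto (fun c : ℝ≥0 => (c : ℝ≥0∞) * ν A) (𝓝[>] 1) (𝓝 (ν A)) := by
    have h1 : Tendsto (fun c : ℝ≥0 => (c : ℝ≥0∞)) (𝓝[>] 1) (𝓝 1) :=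
      (ENNReal.continuous_coe.tendsto' 1 1 (by simp)).mono_left nhdsWithin_le_nhds
    simpa using ENNReal.Tendsto.mul_const h1 (Or.inr htop)
  exact ge_of_tendsto ht (by filter_upwards [self_mem_nhdsWithin] with c hc using key c hc)

theorem euclideanHausdorffMeasure_image_le {X Y : Type*} [EMetricSpace X] [MeasurableSpace X]
    [BorelSpace X] [EMetricSpace Y] [MeasurableSpace Y] [BorelSpace Y] {K : ℝ≥0} {f : X → Y}
    {s : Set X} (h : LipschitzOnWith K f s) (d : ℕ) :
    Measure.euclideanHausdorffMeasure d (f '' s) ≤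
      (K : ℝ≥0∞) ^ d * Measure.euclideanHausdorffMeasure d s := by
  have := h.hausdorffMeasure_image_le (d := d) (by positivity)
  rw [ENNReal.rpow_natCast] at this
  rw [Measure.euclideanHausdorffMeasure_def, Measure.euclideanHausdorffMeasure_def,
    Measure.smul_apply, Measure.smul_apply, ENNReal.smul_def, ENNReal.smul_def, smul_eq_mul,
    smul_eq_mul, mul_left_comm]
  gcongr

section Hypersurface

variable {E : Type*} [NormedAddCommGroup E] [InnerProductSpace ℝ E]

/-- The orthogonal projection onto the hyperplane `v^⊥`. -/
noncomputable def hyperplaneProj (v : E) : E →L[ℝ] (ℝ ∙ v)ᗮ := (ℝ ∙ v)ᗮ.orthogonalProjectionOnto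

theorem coe_hyperplaneProj {v : E} (hv : ‖v‖ = 1) (x : E) :
    (hyperplaneProj v x : E) = x - inner ℝ v x • v := by
  have h1 := Submodule.starProjection_orthogonal_val (K := ℝ ∙ v) x
  have h2 := Submodule.starProjection_unit_singleton ℝ hv x
  rw [h2] at h1
  exact h1

theorem hyperplaneProj_eq_iff {v : E} (hv : ‖v‖ = 1) {x y : E} :
    hyperplaneProj v x = hyperplaneProj v y ↔ ∃ t : ℝ, y = x + t • v := by
  rw [← Subtype.coe_inj, coe_hyperplaneProj hv, coe_hyperplaneProj hv]
  constructor
  · intro h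
    refine ⟨inner ℝ v y - inner ℝ v x, ?_⟩
    rw [sub_smul, ← sub_eq_zero]
    rw [← sub_eq_zero] at h
    rw [← neg_eq_zero, ← h]; abel
  · rintro ⟨t, rfl⟩
    rw [inner_add_right, real_inner_smul_right, real_inner_self_eq_norm_sq, hv, add_smul]
    simp

variable [FiniteDimensional ℝ E]

theorem normDet_hyperplaneProj {v n : E} (hv : ‖v‖ = 1) (hn : ‖n‖ = 1) :
    ((hyperplaneProj v).toLinearMap ∘ₗ (ℝ ∙ n)ᗮ.subtype).normDet = |inner ℝ n v| := by
  set T := (hyperplaneProj v).toLinearMap ∘ₗ (ℝ ∙ n)ᗮ.subtype with hT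
  set w := hyperplaneProj n v
  let g : (ℝ ∙ n)ᗮ →ₗ[ℝ] ℝ := -((innerSL ℝ v).toLinearMap ∘ₗ (ℝ ∙ n)ᗮ.subtype)
  have hg : ∀ x : (ℝ ∙ n)ᗮ, g x = - inner ℝ v (x : E) := fun x => rfl
  have horth : ∀ x : (ℝ ∙ n)ᗮ, inner ℝ n (x : E) = 0 := fun x =>
    Submodule.mem_orthogonal_singleton_iff_inner_right.1 x.2
  have hw : ∀ x : (ℝ ∙ n)ᗮ, inner ℝ (w : E) (x : E) = inner ℝ v (x : E) := by
    intro x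
    rw [coe_hyperplaneProj hn, inner_sub_left, real_inner_smul_left, horth]; ring
  have hadj : T.adjoint ∘ₗ T = LinearMap.transvection g w := by
    ext1 x
    refine ext_inner_right ℝ fun y => ?_
    rw [LinearMap.comp_apply, LinearMap.adjoint_inner_left, LinearMap.transvection.apply,
      Submodule.coe_inner, Submodule.coe_inner]
    change inner ℝ (hyperplaneProj v x : E) (hyperplaneProj v y : E) = _
    rw [coe_hyperplaneProj hv, coe_hyperplaneProj hv, Submodule.coe_add, Submodule.coe_smul, hg,
      inner_add_left, real_inner_smul_left, hw]
    simp only [inner_sub_left, inner_sub_right, real_inner_smul_left, real_inner_smul_right,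
      real_inner_self_eq_norm_sq, hv, real_inner_comm v]
    ring
  have hdet := T.normDet_sq
  rw [hadj, LinearMap.transvection.det, hg, coe_hyperplaneProj hn] at hdet
  rw [← abs_of_nonneg T.normDet_nonneg, ← sq_eq_sq_iff_abs_eq_abs]
  simp only [inner_sub_right, real_inner_smul_right, real_inner_self_eq_norm_sq, hv,
    real_inner_comm n v] at hdet ⊢
  simp only [RCLike.ofReal_real_eq_id, id] at hdet
  rw [hdet]
  ring

variable [MeasurableSpace E] [BorelSpace E]

theorem measure_hyperplaneProj_image {d : ℕ} (hE : finrank ℝ E = d + 1) {v n : E} (hv : ‖v‖ = 1)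
    (hn : ‖n‖ = 1) {B : Set E} (hB : ∀ x ∈ B, inner ℝ n x = 0) :
    Measure.euclideanHausdorffMeasure d (hyperplaneProj v '' B) =
      ENNReal.ofReal |inner ℝ n v| * Measure.euclideanHausdorffMeasure d B := by
  have hn0 : n ≠ 0 := by rintro rfl; simp at hn
  have : Fact (finrank ℝ E = d + 1) := ⟨hE⟩
  have hfr : finrank ℝ (ℝ ∙ n)ᗮ = d := Submodule.finrank_orthogonal_span_singleton hn0
  set B' : Set (ℝ ∙ n)ᗮ := Subtype.val ⁻¹' B
  have hBB : B = (Subtype.val : (ℝ ∙ n)ᗮ → E) '' B' := by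
    refine ((Subtype.image_preimage_coe _ _).trans (inter_eq_right.2 ?_)).symm
    exact fun x hx => Submodule.mem_orthogonal_singleton_iff_inner_right.2 (hB x hx)
  have := ((hyperplaneProj v).toLinearMap ∘ₗ (ℝ ∙ n)ᗮ.subtype).euclideanHausdorffMeasure_image B'
  rw [normDet_hyperplaneProj hv hn, hfr] at this
  have hiso : Measure.euclideanHausdorffMeasure d B = Measure.euclideanHausdorffMeasure d B' := by
    rw [hBB]
    exact (ℝ ∙ n)ᗮ.subtypeₗᵢ.isometry.euclideanHausdorffMeasure_image B'
  rw [hiso, ← this, hBB, image_image]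
  rfl

/-- On a set which is almost contained in the hyperplane `n^⊥`, the projection along `v` changes
`d`-dimensional area almost by the factor `⟪n, v⟫`. -/
theorem measure_hyperplaneProj_image_of_flat {d : ℕ} (hE : finrank ℝ E = d + 1) {v n : E}
    (hv : ‖v‖ = 1) (hn : ‖n‖ = 1) (hnv : 0 < inner ℝ n v) {η : ℝ≥0} (hη : η < 1) {A : Set E}
    (hA : ∀ y ∈ A, ∀ z ∈ A, |inner ℝ n (y - z)| ≤ η * inner ℝ n v * ‖y - z‖) :
    Measure.euclideanHausdorffMeasure d (hyperplaneProj v '' A) ≤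
        (1 + η : ℝ≥0) ^ d * (ENNReal.ofReal (inner ℝ n v) *
          Measure.euclideanHausdorffMeasure d A) ∧
      ENNReal.ofReal (inner ℝ n v) * Measure.euclideanHausdorffMeasure d A ≤
        ((1 - η)⁻¹ : ℝ≥0) ^ d * Measure.euclideanHausdorffMeasure d (hyperplaneProj v '' A) := by
  set q : E → E := fun y => y - (inner ℝ n y / inner ℝ n v) • v with hq
  have hqd : ∀ y ∈ A, ∀ z ∈ A, ‖(q y - q z) - (y - z)‖ ≤ η * ‖y - z‖ := by
    intro y hy z hz
    have : (q y - q z) - (y - z) = -((inner ℝ n (y - z) / inner ℝ n v) • v) := by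
      simp only [hq, inner_sub_right, sub_div, sub_smul]; abel
    rw [this, norm_neg, norm_smul, hv, mul_one, Real.norm_eq_abs, abs_div, abs_of_pos hnv,
      div_le_iff₀ hnv]
    linarith [hA y hy z hz]
  have hL : LipschitzOnWith (1 + η) q A := by
    refine LipschitzOnWith.of_dist_le_mul fun y hy z hz => ?_
    rw [dist_eq_norm, dist_eq_norm]
    have h1 := hqd y hy z hz
    have h2 := norm_sub_norm_le (q y - q z) (y - z)
    push_cast
    nlinarith
  have hlow : ∀ y ∈ A, ∀ z ∈ A, ‖y - z‖ ≤ ((1 - η)⁻¹ : ℝ≥0) * ‖q y - q z‖ := by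
    intro y hy z hz
    have h1 := hqd y hy z hz
    have h2 := norm_sub_norm_le (y - z) (q y - q z)
    rw [norm_sub_rev (y - z)] at h2
    have h3 : (0 : ℝ) < 1 - η := by simpa using (NNReal.coe_lt_coe.2 hη)
    rw [NNReal.coe_inv, NNReal.coe_sub hη.le, NNReal.coe_one, inv_mul_eq_div, le_div_iff₀ h3]
    nlinarith
  have hinj : InjOn q A := by
    intro y hy z hz h
    have := hlow y hy z hz
    rw [h, sub_self, norm_zero, mul_zero] at this
    exact sub_eq_zero.1 (norm_le_zero_iff.1 this)
  have hL' : LipschitzOnWith (1 - η)⁻¹ (Function.invFunOn q A) (q '' A) := by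
    refine LipschitzOnWith.of_dist_le_mul ?_
    rintro _ ⟨y, hy, rfl⟩ _ ⟨z, hz, rfl⟩
    rw [hinj.leftInvOn_invFunOn hy, hinj.leftInvOn_invFunOn hz, dist_eq_norm, dist_eq_norm]
    exact hlow y hy z hz
  have himg : Function.invFunOn q A '' (q '' A) = A := hinj.leftInvOn_invFunOn.image_image
  have hqn : ∀ x ∈ q '' A, inner ℝ n x = 0 := by
    rintro _ ⟨y, -, rfl⟩
    simp only [hq, inner_sub_right, real_inner_smul_right]
    rw [div_mul_cancel₀ _ hnv.ne', sub_self]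
  have hpq : hyperplaneProj v '' (q '' A) = hyperplaneProj v '' A := by
    rw [image_image]
    refine image_congr fun y _ => ?_
    rw [eq_comm, hyperplaneProj_eq_iff hv]
    exact ⟨-(inner ℝ n y / inner ℝ n v), by simp [hq, sub_eq_add_neg]⟩
  have hm := measure_hyperplaneProj_image hE hv hn hqn
  rw [hpq, abs_of_pos hnv] at hm
  have u1 := euclideanHausdorffMeasure_image_le hL d
  have u2 := euclideanHausdorffMeasure_image_le hL' d
  rw [himg] at u2
  constructor
  · rw [hm, mul_left_comm]
    gcongr
  · rw [hm, mul_left_comm]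
    gcongr

end Hypersurface

section Transverse

/-- The zero set of `ρ` in `U`. -/
def zeroSet {E : Type*} (ρ : E → ℝ) (U : Set E) : Set E := {y | y ∈ U ∧ ρ y = 0}

variable {E : Type*} [NormedAddCommGroup E] [InnerProductSpace ℝ E] [FiniteDimensional ℝ E]

/-- `ρ` is continuously differentiable on the convex open set `U`, with positive derivative in the
direction `v`. -/
structure IsTransverse (ρ : E → ℝ) (v : E) (U : Set E) : Prop where
  isOpen : IsOpen U
  convex : Convex ℝ U
  contDiffAt : ∀ y ∈ U, ContDiffAt ℝ 1 ρ y
  inner_pos : ∀ y ∈ U, 0 < inner ℝ (gradient ρ y) v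

/-- The normalized gradient of `ρ`. -/
noncomputable def unitNormal (ρ : E → ℝ) (y : E) : E := ‖gradient ρ y‖⁻¹ • gradient ρ y

variable {ρ : E → ℝ} {v : E} {U : Set E}

theorem continuousAt_gradient {y : E} (h : ContDiffAt ℝ 1 ρ y) : ContinuousAt (gradient ρ) y :=
  (LinearIsometryEquiv.continuous _).continuousAt.comp
    (h.fderiv_right (m := 0) (by norm_num)).continuousAt

namespace IsTransverse

theorem gradient_ne_zero (h : IsTransverse ρ v U) {y : E} (hy : y ∈ U) : gradient ρ y ≠ 0 := by
  intro h0
  have := h.inner_pos y hy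
  simp [h0] at this

theorem norm_unitNormal (h : IsTransverse ρ v U) {y : E} (hy : y ∈ U) :
    ‖unitNormal ρ y‖ = 1 := by
  rw [unitNormal, norm_smul, norm_inv, norm_norm,
    inv_mul_cancel₀ (norm_ne_zero_iff.2 (h.gradient_ne_zero hy))]

theorem inner_unitNormal_pos (h : IsTransverse ρ v U) {y : E} (hy : y ∈ U) :
    0 < inner ℝ (unitNormal ρ y) v := by
  rw [unitNormal, real_inner_smul_left]
  exact mul_pos (inv_pos.2 (norm_pos_iff.2 (h.gradient_ne_zero hy))) (h.inner_pos y hy)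

theorem continuousAt_unitNormal (h : IsTransverse ρ v U) {y : E} (hy : y ∈ U) :
    ContinuousAt (unitNormal ρ) y := by
  have hg := continuousAt_gradient (h.contDiffAt y hy)
  exact (hg.norm.inv₀ (norm_ne_zero_iff.2 (h.gradient_ne_zero hy))).smul hg

theorem differentiableAt (h : IsTransverse ρ v U) {y : E} (hy : y ∈ U) :
    DifferentiableAt ℝ ρ y := (h.contDiffAt y hy).differentiableAt (by norm_num)

theorem convex_line (h : IsTransverse ρ v U) (y : E) : Convex ℝ {t : ℝ | y + t • v ∈ U} := by
  intro s hs t ht a b ha hb hab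
  have := h.convex hs ht ha hb hab
  have e : y + (a • s + b • t) • v = a • (y + s • v) + b • (y + t • v) := by
    obtain rfl : b = 1 - a := by linarith
    module
  change y + (a • s + b • t) • v ∈ U
  rwa [e]

theorem strictMonoOn_line (h : IsTransverse ρ v U) (y : E) :
    StrictMonoOn (fun t : ℝ => ρ (y + t • v)) {t | y + t • v ∈ U} := by
  have hopen : IsOpen {t : ℝ | y + t • v ∈ U} := h.isOpen.preimage (by fun_prop)
  have hder : ∀ t ∈ {t : ℝ | y + t • v ∈ U}, HasDerivAt (fun t : ℝ => ρ (y + t • v))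
      (inner ℝ (gradient ρ (y + t • v)) v) t := by
    intro t ht
    have hline : HasDerivAt (fun t : ℝ => y + t • v) v t := by
      simpa using ((hasDerivAt_id t).smul_const v).const_add y
    have := (h.differentiableAt ht).hasFDerivAt.comp_hasDerivAt t hline
    rw [inner_gradient_left]
    exact this
  refine strictMonoOn_of_deriv_pos (h.convex_line y)
    (fun t ht => (hder t ht).continuousAt.continuousWithinAt) fun t ht => ?_
  rw [hopen.interior_eq] at ht
  rw [(hder t ht).deriv]
  exact h.inner_pos _ ht

theorem injOn_hyperplaneProj (h : IsTransverse ρ v U) (hv : ‖v‖ = 1) :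
    InjOn (hyperplaneProj v) (zeroSet ρ U) := by
  intro y hy z hz hyz
  obtain ⟨t, rfl⟩ := (hyperplaneProj_eq_iff hv).1 hyz
  have := (h.strictMonoOn_line y).injOn (x₁ := (0 : ℝ)) (x₂ := t) (by simpa using hy.1) hz.1
    (by simp [hy.2, hz.2])
  simp [← this]

theorem measurableSet_zeroSet [MeasurableSpace E] [BorelSpace E] (h : IsTransverse ρ v U) :
    MeasurableSet (zeroSet ρ U) := by
  have hc : ContinuousOn ρ U := fun y hy => (h.contDiffAt y hy).continuousAt.continuousWithinAt
  obtain ⟨C, hC, hCU⟩ := continuousOn_iff_isClosed.1 hc {0} isClosed_singleton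
  have : zeroSet ρ U = C ∩ U := by
    rw [← hCU]; ext y; simp [zeroSet, and_comm]
  rw [this]
  exact hC.measurableSet.inter h.isOpen.measurableSet

theorem exists_flat_nhds (h : IsTransverse ρ v U) {x : E} (hx : x ∈ zeroSet ρ U) {δ : ℝ}
    (hδ : 0 < δ) : ∃ W ∈ 𝓝 x, ∀ y ∈ W ∩ zeroSet ρ U, ∀ z ∈ W ∩ zeroSet ρ U,
      |inner ℝ (unitNormal ρ x) (y - z)| ≤ δ * ‖y - z‖ := by
  have hg : 0 < ‖gradient ρ x‖ := norm_pos_iff.2 (h.gradient_ne_zero hx.1)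
  have hs := (h.contDiffAt x hx.1).hasStrictFDerivAt (by norm_num)
  have := hs.isLittleO.def (mul_pos hδ hg)
  rw [nhds_prod_eq] at this
  obtain ⟨W, hW, hWW⟩ := mem_prod_same_iff.1 this
  refine ⟨W, hW, fun y hy z hz => ?_⟩
  have h1 : ‖ρ y - ρ z - fderiv ℝ ρ x (y - z)‖ ≤ δ * ‖gradient ρ x‖ * ‖y - z‖ :=
    hWW (mk_mem_prod hy.1 hz.1)
  simp only [hy.2.2, hz.2.2, sub_self, zero_sub, norm_neg, Real.norm_eq_abs] at h1
  rw [unitNormal, real_inner_smul_left, inner_gradient_left, abs_mul, abs_inv, abs_norm,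
    inv_mul_le_iff₀ hg]
  linarith

variable [MeasurableSpace E] [BorelSpace E] {d : ℕ}

theorem exists_nhds_measure_compare (hE : finrank ℝ E = d + 1) (hv : ‖v‖ = 1)
    (h : IsTransverse ρ v U) {x : E} (hx : x ∈ zeroSet ρ U) {η : ℝ≥0} (h0 : 0 < η) (hη : η < 1) :
    ∃ W ∈ 𝓝 x, ∀ A ⊆ W ∩ zeroSet ρ U,
      Measure.euclideanHausdorffMeasure d (hyperplaneProj v '' A) ≤
        (1 + η : ℝ≥0) ^ d * (ENNReal.ofReal (inner ℝ (unitNormal ρ x) v) *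
          Measure.euclideanHausdorffMeasure d A) ∧
      ENNReal.ofReal (inner ℝ (unitNormal ρ x) v) * Measure.euclideanHausdorffMeasure d A ≤
        ((1 - η)⁻¹ : ℝ≥0) ^ d * Measure.euclideanHausdorffMeasure d (hyperplaneProj v '' A) := by
  have hp := h.inner_unitNormal_pos hx.1
  obtain ⟨W, hW, hWW⟩ := h.exists_flat_nhds hx (mul_pos (NNReal.coe_pos.2 h0) hp)
  exact ⟨W, hW, fun A hA => measure_hyperplaneProj_image_of_flat hE hv (h.norm_unitNormal hx.1) hp
    hη fun y hy z hz => hWW y (hA hy) z (hA hz)⟩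

theorem euclideanHausdorffMeasure_hyperplane (hE : finrank ℝ E = d + 1) (hv : ‖v‖ = 1) :
    (Measure.euclideanHausdorffMeasure d : Measure (ℝ ∙ v)ᗮ) = volume := by
  have hv0 : v ≠ 0 := by rintro rfl; simp at hv
  have : Fact (finrank ℝ E = d + 1) := ⟨hE⟩
  have hfr : finrank ℝ (ℝ ∙ v)ᗮ = d := Submodule.finrank_orthogonal_span_singleton hv0
  rw [← InnerProductSpace.euclideanHausdorffMeasure_eq_volume, hfr]

theorem exists_nhds_measure_lt_top (hE : finrank ℝ E = d + 1) (hv : ‖v‖ = 1)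
    (h : IsTransverse ρ v U) {x : E} (hx : x ∈ zeroSet ρ U) :
    ∃ W ∈ 𝓝 x, Measure.euclideanHausdorffMeasure d (W ∩ zeroSet ρ U) < ⊤ := by
  obtain ⟨W, hW, hWW⟩ := h.exists_nhds_measure_compare hE hv hx (half_pos one_pos)
    (half_lt_self one_pos)
  refine ⟨W ∩ Metric.ball x 1, inter_mem hW (Metric.ball_mem_nhds _ one_pos), ?_⟩
  set A := W ∩ Metric.ball x 1 ∩ zeroSet ρ U
  have hA : A ⊆ W ∩ zeroSet ρ U := fun y hy => ⟨hy.1.1, hy.2⟩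
  have hb : Bornology.IsBounded (hyperplaneProj v '' A) :=
    ((hyperplaneProj v).lipschitz.isBounded_image Metric.isBounded_ball).subset
      (image_mono (fun y (hy : y ∈ A) => hy.1.2))
  have h1 := (hWW A hA).2
  rw [euclideanHausdorffMeasure_hyperplane hE hv] at h1
  have h2 := h1.trans_lt (ENNReal.mul_lt_top (ENNReal.pow_lt_top ENNReal.coe_lt_top)
    hb.measure_lt_top)
  by_contra hn
  rw [not_lt, top_le_iff] at hn
  rw [hn, ENNReal.mul_top] at h2
  · exact lt_irrefl _ h2
  · simpa using h.inner_unitNormal_pos hx.1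

/-- The projection of a transverse hypersurface to a hyperplane. -/
noncomputable def proj (ρ : E → ℝ) (v : E) (U : Set E) (x : zeroSet ρ U) : (ℝ ∙ v)ᗮ :=
  hyperplaneProj v x

theorem measurableEmbedding_proj (h : IsTransverse ρ v U) (hv : ‖v‖ = 1) :
    MeasurableEmbedding (proj ρ v U) := by
  exact (hyperplaneProj v).continuous.continuousOn.measurableEmbedding h.measurableSet_zeroSet
    (h.injOn_hyperplaneProj hv)

omit [MeasurableSpace E] [BorelSpace E] in
theorem continuous_inner_unitNormal (h : IsTransverse ρ v U) :
    Continuous fun s : zeroSet ρ U => inner ℝ (unitNormal ρ s) v := by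
  refine continuous_iff_continuousAt.2 fun s => ?_
  have h1 : ContinuousAt (fun s : zeroSet ρ U => unitNormal ρ s) s :=
    (h.continuousAt_unitNormal s.2.1).comp (f := Subtype.val) continuousAt_subtype_val
  exact h1.inner continuousAt_const

/-- The area formula for the projection of a transverse hypersurface to a hyperplane. -/
theorem comap_proj_eq (hE : finrank ℝ E = d + 1) (hv : ‖v‖ = 1) (h : IsTransverse ρ v U) :
    (volume : Measure (ℝ ∙ v)ᗮ).comap (proj ρ v U) =
      ((Measure.euclideanHausdorffMeasure d : Measure E).comap Subtype.val).withDensity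
        fun s : zeroSet ρ U => ENNReal.ofReal (inner ℝ (unitNormal ρ s) v) := by
  set σ : Measure (zeroSet ρ U) :=
    (Measure.euclideanHausdorffMeasure d : Measure E).comap Subtype.val with hσ
  set a : zeroSet ρ U → ℝ := fun s => inner ℝ (unitNormal ρ s) v with ha
  have hac : Continuous a := h.continuous_inner_unitNormal
  have hap : ∀ s, 0 < a s := fun s => h.inner_unitNormal_pos s.2.1
  have hemb := h.measurableEmbedding_proj hv
  have hval : MeasurableEmbedding (Subtype.val : zeroSet ρ U → E) :=
    MeasurableEmbedding.subtype_coe h.measurableSet_zeroSet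
  have key : ∀ c : ℝ≥0, 1 < c → ∀ x, ∃ W ∈ 𝓝 x, ∀ A ⊆ W, MeasurableSet A →
      (volume : Measure (ℝ ∙ v)ᗮ).comap (proj ρ v U) A ≤
        c * (σ.withDensity fun s => ENNReal.ofReal (a s)) A ∧
      (σ.withDensity fun s => ENNReal.ofReal (a s)) A ≤
        c * (volume : Measure (ℝ ∙ v)ᗮ).comap (proj ρ v U) A := by
    intro c hc x
    have hlim1 : ∀ᶠ η : ℝ≥0 in 𝓝[>] 0, (1 + η) * (1 + η) ^ d < c := by
      have : Continuous fun η : ℝ≥0 => (1 + η) * (1 + η) ^ d := by fun_prop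
      exact ((this.tendsto' 0 1 (by simp)).mono_left nhdsWithin_le_nhds).eventually (gt_mem_nhds hc)
    have hlim2 : ∀ᶠ η : ℝ≥0 in 𝓝[>] 0, (1 + η) * ((1 - η)⁻¹) ^ d < c := by
      have : ContinuousAt (fun η : ℝ≥0 => (1 + η) * ((1 - η)⁻¹) ^ d) 0 := by
        refine (by fun_prop : ContinuousAt (fun η : ℝ≥0 => 1 + η) 0).mul (ContinuousAt.pow ?_ d)
        exact ContinuousAt.inv₀ (by fun_prop) (by simp)
      have h1 : Tendsto (fun η : ℝ≥0 => (1 + η) * ((1 - η)⁻¹) ^ d) (𝓝 0) (𝓝 1) := by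
        simpa [ContinuousAt] using this
      exact (h1.mono_left nhdsWithin_le_nhds).eventually (gt_mem_nhds hc)
    have hlim3 : ∀ᶠ η : ℝ≥0 in 𝓝[>] 0, η < 1 :=
      nhdsWithin_le_nhds (gt_mem_nhds zero_lt_one)
    obtain ⟨η, ⟨⟨h1, h2⟩, h3⟩, h4⟩ := (((hlim1.and hlim2).and hlim3).and
      self_mem_nhdsWithin).exists
    have h4' : (0 : ℝ) < η := NNReal.coe_pos.2 h4
    obtain ⟨W, hW, hWW⟩ := h.exists_nhds_measure_compare hE hv x.2 h4 h3
    have hclose1 : ∀ᶠ s in 𝓝 x, a x < (1 + η) * a s := by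
      have : Continuous fun s => (1 + η) * a s := by fun_prop
      refine this.continuousAt.eventually (lt_mem_nhds ?_)
      nlinarith [hap x]
    have hclose2 : ∀ᶠ s in 𝓝 x, a s < (1 + η) * a x := by
      refine hac.continuousAt.eventually (gt_mem_nhds ?_)
      nlinarith [hap x]
    refine ⟨_, inter_mem (inter_mem (continuousAt_subtype_val.preimage_mem_nhds hW) hclose1)
      hclose2, fun A hA hAm => ?_⟩
    have hσA : σ A = Measure.euclideanHausdorffMeasure d (Subtype.val '' A) :=
      hval.comap_apply _ _
    have hA' : Subtype.val '' A ⊆ W ∩ zeroSet ρ U := by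
      rintro _ ⟨s, hs, rfl⟩
      exact ⟨(hA hs).1.1, s.2⟩
    obtain ⟨m1, m2⟩ := hWW _ hA'
    rw [image_image, ← hσA, euclideanHausdorffMeasure_hyperplane hE hv] at m1 m2
    change volume (proj ρ v U '' A) ≤ _ at m1
    change _ ≤ _ * volume (proj ρ v U '' A) at m2
    change _ ≤ _ * (ENNReal.ofReal (a x) * _) at m1
    change ENNReal.ofReal (a x) * _ ≤ _ at m2
    rw [hemb.comap_apply, withDensity_apply _ hAm]
    have i1 : ENNReal.ofReal (a x) * σ A ≤
        (1 + η : ℝ≥0) * ∫⁻ s in A, ENNReal.ofReal (a s) ∂σ := by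
      rw [← setLIntegral_const, ← lintegral_const_mul _ (by fun_prop)]
      refine setLIntegral_mono (by fun_prop) fun s hs => ?_
      rw [← ENNReal.ofReal_coe_nnreal, ← ENNReal.ofReal_mul (by positivity)]
      exact ENNReal.ofReal_le_ofReal (by push_cast; exact (hA hs).1.2.le)
    have i2 : ∫⁻ s in A, ENNReal.ofReal (a s) ∂σ ≤
        (1 + η : ℝ≥0) * (ENNReal.ofReal (a x) * σ A) := by
      rw [← setLIntegral_const, ← lintegral_const_mul _ (by fun_prop)]
      refine setLIntegral_mono (by fun_prop) fun s hs => ?_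
      rw [← ENNReal.ofReal_coe_nnreal, ← ENNReal.ofReal_mul (by positivity)]
      exact ENNReal.ofReal_le_ofReal (by push_cast; exact (hA hs).2.le)
    constructor
    · calc volume (proj ρ v U '' A)
          ≤ (1 + η : ℝ≥0) ^ d * ((1 + η : ℝ≥0) * ∫⁻ s in A, ENNReal.ofReal (a s) ∂σ) :=
            m1.trans (by gcongr)
        _ = ((1 + η) * (1 + η) ^ d : ℝ≥0) * ∫⁻ s in A, ENNReal.ofReal (a s) ∂σ := by
            push_cast; ring
        _ ≤ _ := by gcongr
    · calc ∫⁻ s in A, ENNReal.ofReal (a s) ∂σ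
          ≤ (1 + η : ℝ≥0) * (((1 - η)⁻¹ : ℝ≥0) ^ d * volume (proj ρ v U '' A)) :=
            i2.trans (by gcongr)
        _ = ((1 + η) * ((1 - η)⁻¹) ^ d : ℝ≥0) * volume (proj ρ v U '' A) := by
            rw [ENNReal.coe_mul, ENNReal.coe_pow, mul_assoc]
        _ ≤ _ := by gcongr
  refine le_antisymm (measure_le_of_locally_le_mul fun c hc x => ?_)
    (measure_le_of_locally_le_mul fun c hc x => ?_)
  · obtain ⟨W, hW, hWW⟩ := key c hc x
    exact ⟨W, hW, fun A hA hAm => (hWW A hA hAm).1⟩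
  · obtain ⟨W, hW, hWW⟩ := key c hc x
    exact ⟨W, hW, fun A hA hAm => (hWW A hA hAm).2⟩

/-- Integration over a transverse hypersurface as an integral over its projection. -/
theorem integral_image_proj (hE : finrank ℝ E = d + 1) (hv : ‖v‖ = 1) (h : IsTransverse ρ v U)
    (G : (ℝ ∙ v)ᗮ → ℝ) (hG : ∀ p ∉ hyperplaneProj v '' zeroSet ρ U, G p = 0) :
    ∫ p, G p = ∫ x in zeroSet ρ U, inner ℝ (unitNormal ρ x) v * G (hyperplaneProj v x)
      ∂(Measure.euclideanHausdorffMeasure d) := by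
  have hemb := h.measurableEmbedding_proj hv
  have hr : range (proj ρ v U) = hyperplaneProj v '' zeroSet ρ U := by
    ext p; simp [proj]
  rw [← setIntegral_eq_integral_of_forall_compl_eq_zero (s := range (proj ρ v U))
    (fun p hp => hG p (hr ▸ hp)), ← hemb.map_comap, hemb.integral_map, h.comap_proj_eq hE hv,
    integral_withDensity_eq_integral_toReal_smul
      (h.continuous_inner_unitNormal.measurable.ennreal_ofReal) (by simp),
    ← integral_subtype_comap h.measurableSet_zeroSet]
  refine integral_congr_ae (Eventually.of_forall fun s => ?_)
  simp only [ENNReal.toReal_ofReal (h.inner_unitNormal_pos s.2.1).le, smul_eq_mul]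
  rfl

end IsTransverse

end Transverse

section Hypersurface

variable {E : Type*} [NormedAddCommGroup E] [InnerProductSpace ℝ E]
variable {ρ : E → ℝ} {v : E} {U : Set E} {Ω : Set E} {f : E → ℝ}

theorem hasDerivAt_comp_line (hf : ContDiff ℝ 1 f) (y : E) (t : ℝ) :
    HasDerivAt (fun t : ℝ => f (y + t • v)) (fderiv ℝ f (y + t • v) v) t := by
  have hline : HasDerivAt (fun t : ℝ => y + t • v) v t := by
    simpa using ((hasDerivAt_id t).smul_const v).const_add y
  exact (hf.differentiable one_ne_zero _).hasFDerivAt.comp_hasDerivAt t hline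

theorem hasCompactSupport_comp_line (hv : ‖v‖ = 1) (hfc : HasCompactSupport f) (y : E) :
    HasCompactSupport fun t : ℝ => f (y + t • v) := by
  have hv0 : v ≠ 0 := by rintro rfl; simp at hv
  refine hfc.comp_isClosedEmbedding (g := fun t : ℝ => y + t • v) ?_
  exact (Homeomorph.addLeft y).isClosedEmbedding.comp (isClosedEmbedding_smul_left hv0)

theorem fderiv_eq_zero_of_notMem (hfU : tsupport f ⊆ U) {z : E} (hz : z ∉ U) :
    fderiv ℝ f z = 0 :=
  image_eq_zero_of_notMem_tsupport fun h => hz (hfU (tsupport_fderiv_subset ℝ h))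

theorem integral_line_eq_zero (hv : ‖v‖ = 1) (hf : ContDiff ℝ 1 f) (hfc : HasCompactSupport f)
    (y : E) : ∫ t : ℝ, fderiv ℝ f (y + t • v) v = 0 := by
  have hg := hasCompactSupport_comp_line hv hfc y
  have hgd : ContDiff ℝ 1 fun t : ℝ => f (y + t • v) := hf.comp (by fun_prop)
  have hd : deriv (fun t : ℝ => f (y + t • v)) = fun t => fderiv ℝ f (y + t • v) v :=
    funext fun t => (hasDerivAt_comp_line hf y t).deriv
  rw [← hd]
  refine integral_eq_zero_of_hasDerivAt_of_integrable
    (fun t => (hgd.differentiable one_ne_zero t).hasDerivAt) ?_ ?_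
  · exact (hgd.continuous_deriv le_rfl).integrable_of_hasCompactSupport hg.deriv
  · exact hgd.continuous.integrable_of_hasCompactSupport hg

variable [FiniteDimensional ℝ E]

namespace IsTransverse

theorem integral_line_of_mem (h : IsTransverse ρ v U) (hv : ‖v‖ = 1)
    (hΩ : ∀ y ∈ U, y ∈ Ω ↔ ρ y ≤ 0) (hf : ContDiff ℝ 1 f) (hfc : HasCompactSupport f)
    (hfU : tsupport f ⊆ U) {y : E} {t₀ : ℝ} (hy : y + t₀ • v ∈ zeroSet ρ U) :
    ∫ t : ℝ, Ω.indicator (fun z => fderiv ℝ f z v) (y + t • v) = f (y + t₀ • v) := by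
  have hgd : ContDiff ℝ 1 fun t : ℝ => f (y + t • v) := hf.comp (by fun_prop)
  rw [← (hasCompactSupport_comp_line hv hfc y).integral_Iic_deriv_eq hgd t₀,
    ← integral_indicator measurableSet_Iic]
  refine integral_congr_ae (Eventually.of_forall fun t => ?_)
  simp only [indicator, mem_Iic, (hasDerivAt_comp_line hf y t).deriv]
  by_cases htU : y + t • v ∈ U
  · have hiff : ρ (y + t • v) ≤ 0 ↔ t ≤ t₀ := by
      rw [← hy.2]
      exact (h.strictMonoOn_line y).le_iff_le htU hy.1
    simp only [(hΩ _ htU).trans hiff]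
  · simp [fderiv_eq_zero_of_notMem hfU htU]

theorem integral_line_of_notMem (h : IsTransverse ρ v U) (hv : ‖v‖ = 1)
    (hΩ : ∀ y ∈ U, y ∈ Ω ↔ ρ y ≤ 0) (hf : ContDiff ℝ 1 f) (hfc : HasCompactSupport f)
    (hfU : tsupport f ⊆ U) {y : E} (hy : ∀ t : ℝ, y + t • v ∉ zeroSet ρ U) :
    ∫ t : ℝ, Ω.indicator (fun z => fderiv ℝ f z v) (y + t • v) = 0 := by
  have hpre : IsPreconnected {t : ℝ | y + t • v ∈ U} := (h.convex_line y).isPreconnected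
  have hcont : ContinuousOn (fun t : ℝ => ρ (y + t • v)) {t | y + t • v ∈ U} := fun t ht =>
    ((h.differentiableAt ht).continuousAt.comp (f := fun t : ℝ => y + t • v)
      (by fun_prop)).continuousWithinAt
  have hne : ∀ t ∈ {t : ℝ | y + t • v ∈ U}, ρ (y + t • v) ≠ 0 := fun t ht h0 => hy t ⟨ht, h0⟩
  have hcases : (∀ t : ℝ, y + t • v ∈ U → y + t • v ∈ Ω) ∨
      (∀ t : ℝ, y + t • v ∈ U → y + t • v ∉ Ω) := by
    by_contra! hcon
    obtain ⟨⟨s, hsU, hs⟩, t, htU, ht⟩ := hcon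
    rw [hΩ _ hsU, not_le] at hs
    rw [hΩ _ htU] at ht
    obtain ⟨r, hr, hr0⟩ := hpre.intermediate_value htU hsU hcont (mem_Icc.2 ⟨ht, hs.le⟩)
    exact hne r hr hr0
  rcases hcases with hc | hc
  · rw [← integral_line_eq_zero hv hf hfc y]
    refine integral_congr_ae (Eventually.of_forall fun t => ?_)
    by_cases htU : y + t • v ∈ U
    · exact indicator_of_mem (hc t htU) _
    · simp [indicator, fderiv_eq_zero_of_notMem hfU htU]
  · rw [← integral_zero ℝ ℝ]
    refine integral_congr_ae (Eventually.of_forall fun t => ?_)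
    by_cases htU : y + t • v ∈ U
    · exact indicator_of_notMem (hc t htU) _
    · simp [indicator, fderiv_eq_zero_of_notMem hfU htU]

end IsTransverse

variable [MeasurableSpace E] [BorelSpace E]

/-- Fubini's theorem along the lines parallel to a unit vector. -/
theorem integral_eq_integral_lines (hv : ‖v‖ = 1) {g : E → ℝ} (hg : Integrable g) :
    ∫ x, g x = ∫ p : (ℝ ∙ v)ᗮ, ∫ t : ℝ, g (p + t • v) := by
  have hmp := ((ℝ ∙ v).measurePreserving_measurableEquivProd (0 : E)).symm
  rw [InnerProductSpace.euclideanHausdorffMeasure_eq_volume] at hmp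
  have hint := hmp.integrable_comp_of_integrable hg
  refine (hmp.integral_comp' g).symm.trans ((integral_prod_symm _ hint).trans ?_)
  refine integral_congr_ae (Eventually.of_forall fun p => ?_)
  have hl := (LinearIsometryEquiv.toSpanUnitSingleton (𝕜 := ℝ) v hv).measurePreserving
  simp only [Function.comp]
  rw [← hl.integral_comp
    (LinearIsometryEquiv.toSpanUnitSingleton (𝕜 := ℝ) v hv).toMeasurableEquiv.measurableEmbedding]
  refine integral_congr_ae (Eventually.of_forall fun t => ?_)
  simp [add_comm]

theorem integrable_indicator_fderiv (hΩm : MeasurableSet Ω) (hf : ContDiff ℝ 1 f)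
    (hfc : HasCompactSupport f) (v : E) :
    Integrable (Ω.indicator fun z => fderiv ℝ f z v) := by
  refine Integrable.indicator ?_ hΩm
  refine Continuous.integrable_of_hasCompactSupport ?_ (hfc.fderiv_apply ℝ v)
  exact (hf.continuous_fderiv one_ne_zero).clm_apply continuous_const

theorem integral_fderiv_eq_zero_of_tsupport_subset (hv : ‖v‖ = 1)
    (hf : ContDiff ℝ 1 f) (hfc : HasCompactSupport f) (hfΩ : tsupport f ⊆ Ω) :
    ∫ x in Ω, fderiv ℝ f x v = 0 := by
  rw [setIntegral_eq_integral_of_forall_compl_eq_zero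
    (fun x hx => by simp [fderiv_eq_zero_of_notMem hfΩ hx]),
    integral_eq_integral_lines hv]
  · simp [integral_line_eq_zero hv hf hfc]
  · simpa using integrable_indicator_fderiv MeasurableSet.univ hf hfc v

/-- The divergence theorem for a function supported near a transverse hypersurface, in a unit
direction. -/
theorem IsTransverse.integral_fderiv {d : ℕ} (hE : finrank ℝ E = d + 1)
    (h : IsTransverse ρ v U) (hv : ‖v‖ = 1) (hΩm : MeasurableSet Ω)
    (hΩ : ∀ y ∈ U, y ∈ Ω ↔ ρ y ≤ 0) (hf : ContDiff ℝ 1 f) (hfc : HasCompactSupport f)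
    (hfU : tsupport f ⊆ U) :
    ∫ x in Ω, fderiv ℝ f x v = ∫ x in zeroSet ρ U, inner ℝ (unitNormal ρ x) v * f x
      ∂(Measure.euclideanHausdorffMeasure d) := by
  rw [← integral_indicator hΩm,
    integral_eq_integral_lines hv (integrable_indicator_fderiv hΩm hf hfc v),
    h.integral_image_proj hE hv]
  · refine setIntegral_congr_fun h.measurableSet_zeroSet fun x hx => ?_
    have hx' : (hyperplaneProj v x : E) + (inner ℝ v x : ℝ) • v = x := by
      rw [coe_hyperplaneProj hv]; simp
    have := h.integral_line_of_mem hv hΩ hf hfc hfU (y := hyperplaneProj v x)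
      (t₀ := inner ℝ v x) (by rwa [hx'])
    simp only [this, hx']
  · intro p hp
    refine h.integral_line_of_notMem hv hΩ hf hfc hfU fun t ht => hp ⟨_, ht, ?_⟩
    rw [← (hyperplaneProj_eq_iff hv).2 ⟨t, rfl⟩]
    exact Submodule.orthogonalProjectionOnto_mem_subspace_eq_self p

end Hypersurface

section Divergence

variable {d : ℕ} {Ω : Set (Spacetime d)}

theorem finrank_spacetime (d : ℕ) : finrank ℝ (Spacetime d) = d + 1 := by simp

/-- Near a boundary point, a defining function describes the boundary and its normal. -/
theorem IsDefiningFunctionAt.exists_ball (hΩ : IsClosed Ω) {x v : Spacetime d}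
    {ρ : Spacetime d → ℝ} (h : IsDefiningFunctionAt Ω x ρ)
    (hv : 0 < inner ℝ (gradient ρ x) v) :
    ∃ R > 0, IsTransverse ρ v (Metric.ball x R) ∧
      (∀ y ∈ Metric.ball x R, (y ∈ Ω ↔ ρ y ≤ 0)) ∧
      frontier Ω ∩ Metric.ball x R = zeroSet ρ (Metric.ball x R) ∧
      ∀ y ∈ zeroSet ρ (Metric.ball x R), outwardNormal Ω y = unitNormal ρ y := by
  have hc1 : ContDiffAt ℝ 1 ρ x := h.smooth.self_of_nhds.of_le (by exact_mod_cast le_top)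
  have hpos : ∀ᶠ y in 𝓝 x, 0 < inner ℝ (gradient ρ y) v :=
    ((continuousAt_gradient hc1).inner continuousAt_const).eventually (lt_mem_nhds hv)
  obtain ⟨R, hR, hball⟩ := Metric.eventually_nhds_iff_ball.1
    ((h.smooth.and h.mem_iff).and hpos)
  have hnhds : ∀ y ∈ Metric.ball x R, Metric.ball x R ∈ 𝓝 y := fun y hy =>
    Metric.isOpen_ball.mem_nhds hy
  have htr : IsTransverse ρ v (Metric.ball x R) :=
    { isOpen := Metric.isOpen_ball
      convex := convex_ball x R
      contDiffAt := fun y hy => (hball y hy).1.1.of_le (by exact_mod_cast le_top)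
      inner_pos := fun y hy => (hball y hy).2 }
  have hdef : ∀ y ∈ zeroSet ρ (Metric.ball x R), IsDefiningFunctionAt Ω y ρ := fun y hy =>
    { smooth := by filter_upwards [hnhds y hy.1] with z hz using (hball z hz).1.1
      eq_zero := hy.2
      gradient_ne_zero := htr.gradient_ne_zero hy.1
      mem_iff := by filter_upwards [hnhds y hy.1] with z hz using (hball z hz).1.2 }
  refine ⟨R, hR, htr, fun y hy => (hball y hy).1.2, ?_, fun y hy => outwardNormal_eq (hdef y hy)⟩
  ext y
  constructor
  · rintro ⟨hyf, hy⟩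
    refine ⟨hy, le_antisymm (((hball y hy).1.2).1 (hΩ.frontier_subset hyf)) ?_⟩
    by_contra! hlt
    refine hyf.2 (mem_interior_iff_mem_nhds.2 ?_)
    filter_upwards [hnhds y hy, (htr.differentiableAt hy).continuousAt.eventually (gt_mem_nhds hlt)]
      with z hz hz0 using ((hball z hz).1.2).2 hz0.le
  · intro hy
    refine ⟨?_, hy.1⟩
    rw [hΩ.frontier_eq]
    refine ⟨((hball y hy.1).1.2).2 hy.2.le, fun hint => ?_⟩
    have hev := eventually_pos_of_inner_gradient_pos (htr.differentiableAt hy.1) hy.2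
      (htr.inner_pos y hy.1)
    have hc : Tendsto (fun t : ℝ => y + t • v) (𝓝[>] 0) (𝓝 y) := by
      have : Continuous (fun t : ℝ => y + t • v) := by fun_prop
      simpa using (this.tendsto 0).mono_left nhdsWithin_le_nhds
    obtain ⟨t, ⟨ht, htΩ⟩, htb⟩ := ((hev.and (hc.eventually (mem_interior_iff_mem_nhds.1 hint))).and
      (hc.eventually (hnhds y hy.1))).exists
    exact absurd (((hball _ htb).1.2).1 htΩ) (not_le.2 ht)

theorem IsDefiningFunctionAt.inner_gradient_self_pos {x : Spacetime d} {ρ : Spacetime d → ℝ}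
    (h : IsDefiningFunctionAt Ω x ρ) : 0 < inner ℝ (gradient ρ x) (gradient ρ x) :=
  real_inner_self_pos.2 h.gradient_ne_zero

/-- Rescaling of the transverse direction. -/
theorem IsTransverse.smul {ρ : Spacetime d → ℝ} {v : Spacetime d} {U : Set (Spacetime d)}
    (h : IsTransverse ρ v U) {c : ℝ} (hc : 0 < c) : IsTransverse ρ (c • v) U :=
  { isOpen := h.isOpen
    convex := h.convex
    contDiffAt := h.contDiffAt
    inner_pos := fun y hy => by
      rw [real_inner_smul_right]
      exact mul_pos hc (h.inner_pos y hy) }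

theorem continuousOn_outwardNormal (hΩ : IsClosed Ω) (hs : HasSmoothBoundary Ω) :
    ContinuousOn (outwardNormal Ω) (frontier Ω) := by
  intro x hx
  obtain ⟨ρ, hρ⟩ := hs x hx
  obtain ⟨R, hR, htr, -, hfr, hn⟩ := hρ.exists_ball hΩ hρ.inner_gradient_self_pos
  have hxb := Metric.mem_ball_self (x := x) hR
  have hev : ∀ y ∈ frontier Ω ∩ Metric.ball x R, outwardNormal Ω y = unitNormal ρ y := fun y hy =>
    hn y (hfr ▸ hy)
  refine (htr.continuousAt_unitNormal hxb).continuousWithinAt.congr_of_eventuallyEq ?_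
    (hev x ⟨hx, hxb⟩)
  filter_upwards [self_mem_nhdsWithin, mem_nhdsWithin_of_mem_nhds (Metric.ball_mem_nhds x hR)]
    with y hy hyb using hev y ⟨hy, hyb⟩

theorem IsTransverse.normalize {ρ : Spacetime d → ℝ} {v : Spacetime d} {U : Set (Spacetime d)}
    (h : IsTransverse ρ v U) (hv : v ≠ 0) :
    ‖‖v‖⁻¹ • v‖ = 1 ∧ IsTransverse ρ (‖v‖⁻¹ • v) U :=
  ⟨by rw [norm_smul, norm_inv, norm_norm, inv_mul_cancel₀ (norm_ne_zero_iff.2 hv)],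
    h.smul (inv_pos.2 (norm_pos_iff.2 hv))⟩

theorem isCompact_frontier (hΩ : IsCompact Ω) : IsCompact (frontier Ω) :=
  hΩ.of_isClosed_subset isClosed_frontier hΩ.isClosed.frontier_subset

theorem measure_frontier_lt_top (hΩ : IsCompact Ω) (hs : HasSmoothBoundary Ω) :
    Measure.euclideanHausdorffMeasure d (frontier Ω) < ⊤ := by
  refine (isCompact_frontier hΩ).measure_lt_top_of_nhdsWithin fun x hx => ?_
  obtain ⟨ρ, hρ⟩ := hs x hx
  obtain ⟨R, hR, htr, -, hfr, -⟩ := hρ.exists_ball hΩ.isClosed hρ.inner_gradient_self_pos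
  have hxb := Metric.mem_ball_self (x := x) hR
  obtain ⟨hv, htr'⟩ := htr.normalize hρ.gradient_ne_zero
  have hxz : x ∈ zeroSet ρ (Metric.ball x R) := hfr ▸ mem_inter hx hxb
  obtain ⟨W, hW, hWm⟩ := htr'.exists_nhds_measure_lt_top (finrank_spacetime d) hv hxz
  refine ⟨W ∩ zeroSet ρ (Metric.ball x R), ?_, hWm⟩
  rw [← hfr]
  filter_upwards [self_mem_nhdsWithin, mem_nhdsWithin_of_mem_nhds (Metric.ball_mem_nhds x hR),
    mem_nhdsWithin_of_mem_nhds hW] with y hy hyb hyW using ⟨hyW, hy, hyb⟩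

theorem integrableOn_frontier (hΩ : IsCompact Ω) (hs : HasSmoothBoundary Ω)
    {g : Spacetime d → ℝ} (hg : ContinuousOn g (frontier Ω)) :
    IntegrableOn g (frontier Ω) (Measure.euclideanHausdorffMeasure d) := by
  obtain ⟨C, hC⟩ := (isCompact_frontier hΩ).exists_bound_of_continuousOn hg
  have : IsFiniteMeasure
      ((Measure.euclideanHausdorffMeasure d).restrict (frontier Ω) : Measure (Spacetime d)) :=
    ⟨by simpa using measure_frontier_lt_top hΩ hs⟩
  exact Integrable.of_bound (C := C)
    (hg.aestronglyMeasurable_of_isCompact (isCompact_frontier hΩ)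
      (isCompact_frontier hΩ).measurableSet)
    ((ae_restrict_iff' (isCompact_frontier hΩ).measurableSet).2 (Eventually.of_forall hC))

theorem volume_frontier_eq_zero (hΩ : IsCompact Ω) (hs : HasSmoothBoundary Ω) :
    volume (frontier Ω) = 0 := by
  rw [← EuclideanSpace.euclideanHausdorffMeasure_eq_volume]
  exact (Measure.euclideanHausdorffMeasure_zero_or_top (Nat.lt_succ_self d) _).resolve_right
    (measure_frontier_lt_top hΩ hs).ne

/-- The divergence theorem for functions supported near a boundary point, in a direction
transverse to the boundary. -/
theorem IsDefiningFunctionAt.exists_integral_fderiv (hΩ : IsCompact Ω) {x v : Spacetime d}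
    {ρ : Spacetime d → ℝ} (h : IsDefiningFunctionAt Ω x ρ)
    (hv : 0 < inner ℝ (gradient ρ x) v) :
    ∃ R > 0, ∀ f : Spacetime d → ℝ, ContDiff ℝ 1 f → HasCompactSupport f →
      tsupport f ⊆ Metric.ball x R →
      ∫ y in Ω, fderiv ℝ f y v = ∫ y in frontier Ω, inner ℝ (outwardNormal Ω y) v * f y
        ∂(Measure.euclideanHausdorffMeasure d) := by
  obtain ⟨R, hR, htr, hmem, hfr, hn⟩ := h.exists_ball hΩ.isClosed hv
  have hv0 : v ≠ 0 := by rintro rfl; simp at hv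
  obtain ⟨hu, htr'⟩ := htr.normalize hv0
  refine ⟨R, hR, fun f hf hfc hfU => ?_⟩
  have hkey := htr'.integral_fderiv (finrank_spacetime d) hu hΩ.measurableSet hmem hf hfc hfU
  have hvn : v = ‖v‖ • ‖v‖⁻¹ • v := by
    rw [smul_smul, mul_inv_cancel₀ (norm_ne_zero_iff.2 hv0), one_smul]
  have e1 : ∀ y, fderiv ℝ f y v = ‖v‖ * fderiv ℝ f y (‖v‖⁻¹ • v) := fun y => by
    conv_lhs => rw [hvn, map_smul, smul_eq_mul]
  have e2 : ∀ y, inner ℝ (unitNormal ρ y) v * f y =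
      ‖v‖ * (inner ℝ (unitNormal ρ y) (‖v‖⁻¹ • v) * f y) := fun y => by
    conv_lhs => rw [hvn, real_inner_smul_right, mul_assoc]
  have e3 : ∫ y in frontier Ω, inner ℝ (outwardNormal Ω y) v * f y
      ∂(Measure.euclideanHausdorffMeasure d) =
      ∫ y in zeroSet ρ (Metric.ball x R), inner ℝ (unitNormal ρ y) v * f y
        ∂(Measure.euclideanHausdorffMeasure d) := by
    rw [← hfr, setIntegral_eq_of_subset_of_forall_sdiff_eq_zero
      isClosed_frontier.measurableSet (inter_subset_left (s := frontier Ω) (t := Metric.ball x R))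
      (fun y hy => ?_)]
    · refine setIntegral_congr_fun
        (isClosed_frontier.measurableSet.inter Metric.isOpen_ball.measurableSet) fun y hy => ?_
      simp only [hn y (hfr ▸ hy)]
    · rw [image_eq_zero_of_notMem_tsupport fun hyt => hy.2 ⟨hy.1, hfU hyt⟩, mul_zero]
  rw [e3]
  simp only [e1, e2, integral_const_mul, hkey]

/-- `IsDefiningFunctionAt.exists_integral_fderiv` in an arbitrary direction. -/
theorem exists_ball_integral_fderiv (hΩ : IsCompact Ω) (hs : HasSmoothBoundary Ω)
    {x : Spacetime d} (hx : x ∈ Ω) (e : Spacetime d) :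
    ∃ R > 0, ∀ f : Spacetime d → ℝ, ContDiff ℝ 1 f → HasCompactSupport f →
      tsupport f ⊆ Metric.ball x R →
      ∫ y in Ω, fderiv ℝ f y e = ∫ y in frontier Ω, inner ℝ (outwardNormal Ω y) e * f y
        ∂(Measure.euclideanHausdorffMeasure d) := by
  by_cases hxf : x ∈ frontier Ω
  · obtain ⟨ρ, hρ⟩ := hs x hxf
    set g := gradient ρ x with hg
    have hgg := hρ.inner_gradient_self_pos
    obtain ⟨c, hc⟩ : ∃ c : ℝ, 0 < inner ℝ g (e + c • g) := by
      refine ⟨(1 - inner ℝ g e) / inner ℝ g g, ?_⟩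
      rw [inner_add_right, real_inner_smul_right, div_mul_cancel₀ _ hgg.ne']
      linarith
    obtain ⟨R₁, hR₁, H₁⟩ := hρ.exists_integral_fderiv hΩ hc
    obtain ⟨R₂, hR₂, H₂⟩ := hρ.exists_integral_fderiv hΩ hgg
    refine ⟨min R₁ R₂, lt_min hR₁ hR₂, fun f hf hfc hfU => ?_⟩
    have h1 := H₁ f hf hfc (hfU.trans (Metric.ball_subset_ball (min_le_left _ _)))
    have h2 := H₂ f hf hfc (hfU.trans (Metric.ball_subset_ball (min_le_right _ _)))
    have i1 : ∀ w : Spacetime d, Integrable (fun y => fderiv ℝ f y w) (volume.restrict Ω) :=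
      fun w => ((hf.continuous_fderiv one_ne_zero).clm_apply
        continuous_const).continuousOn.integrableOn_compact hΩ
    have i2 : ∀ w : Spacetime d, Integrable (fun y => inner ℝ (outwardNormal Ω y) w * f y)
        ((Measure.euclideanHausdorffMeasure d).restrict (frontier Ω)) := fun w =>
      integrableOn_frontier hΩ hs
        (((continuousOn_outwardNormal hΩ.isClosed hs).inner continuousOn_const).mul
          hf.continuous.continuousOn)
    have s1 : ∀ y, fderiv ℝ f y e = fderiv ℝ f y (e + c • g) - c * fderiv ℝ f y g := fun y => by
      simp
    have s2 : ∀ y, inner ℝ (outwardNormal Ω y) e * f y =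
        inner ℝ (outwardNormal Ω y) (e + c • g) * f y -
          c * (inner ℝ (outwardNormal Ω y) g * f y) := fun y => by
      rw [inner_add_right, real_inner_smul_right]; ring
    simp only [s1, s2]
    rw [integral_sub (i1 _) ((i1 _).const_mul c), integral_sub (i2 _) ((i2 _).const_mul c),
      integral_const_mul, integral_const_mul, h1, h2]
  · have hxi : x ∈ interior Ω := by
      rw [hΩ.isClosed.frontier_eq] at hxf
      by_contra hn
      exact hxf ⟨hx, hn⟩
    obtain ⟨R, hR, hball⟩ := Metric.isOpen_iff.1 isOpen_interior x hxi
    refine ⟨R, hR, fun f hf hfc hfU => ?_⟩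
    have hfi := hfU.trans hball
    have hr : ∫ y in frontier Ω, inner ℝ (outwardNormal Ω y) e * f y
        ∂(Measure.euclideanHausdorffMeasure d) = 0 := by
      refine setIntegral_eq_zero_of_forall_eq_zero fun y hy => ?_
      rw [image_eq_zero_of_notMem_tsupport fun hyt => hy.2 (hfi hyt), mul_zero]
    rw [hr]
    rcases eq_or_ne e 0 with rfl | he
    · simp
    have hu : ‖‖e‖⁻¹ • e‖ = 1 := by
      rw [norm_smul, norm_inv, norm_norm, inv_mul_cancel₀ (norm_ne_zero_iff.2 he)]
    have := integral_fderiv_eq_zero_of_tsupport_subset hu hf hfc (hfi.trans interior_subset)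
    simp only [map_smul, smul_eq_mul, integral_const_mul] at this
    exact (mul_eq_zero.1 this).resolve_left (inv_ne_zero (norm_ne_zero_iff.2 he))

/-- The divergence theorem on a compact domain with smooth boundary, for the vector field `f • e`
with `e` constant. -/
theorem integral_fderiv_eq_integral_frontier (hΩ : IsCompact Ω) (hs : HasSmoothBoundary Ω)
    {V : Set (Spacetime d)} (hV : IsOpen V) (hΩV : Ω ⊆ V) {f : Spacetime d → ℝ}
    (hf : ContDiffOn ℝ 1 f V) (e : Spacetime d) :
    ∫ y in Ω, fderiv ℝ f y e = ∫ y in frontier Ω, inner ℝ (outwardNormal Ω y) e * f y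
      ∂(Measure.euclideanHausdorffMeasure d) := by
  have hloc : ∀ x ∈ Ω, ∃ R > 0, Metric.ball x R ⊆ V ∧ ∀ f : Spacetime d → ℝ, ContDiff ℝ 1 f →
      HasCompactSupport f → tsupport f ⊆ Metric.ball x R →
      ∫ y in Ω, fderiv ℝ f y e = ∫ y in frontier Ω, inner ℝ (outwardNormal Ω y) e * f y
        ∂(Measure.euclideanHausdorffMeasure d) := by
    intro x hx
    obtain ⟨R₁, hR₁, H₁⟩ := exists_ball_integral_fderiv hΩ hs hx e
    obtain ⟨R₂, hR₂, H₂⟩ := Metric.isOpen_iff.1 hV x (hΩV hx)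
    exact ⟨min R₁ R₂, lt_min hR₁ hR₂, (Metric.ball_subset_ball (min_le_right _ _)).trans H₂,
      fun f hf hfc hfU => H₁ f hf hfc (hfU.trans (Metric.ball_subset_ball (min_le_left _ _)))⟩
  choose! R hR hRV H using hloc
  obtain ⟨t, htΩ, ht⟩ := hΩ.elim_nhds_subcover (fun x => Metric.ball x (R x))
    fun x hx => Metric.ball_mem_nhds x (hR x hx)
  have hcov : Ω ⊆ ⋃ i : t, Metric.ball (i : Spacetime d) (R i) := by
    rwa [iUnion_subtype]
  obtain ⟨K, hK, hΩK, hKb⟩ := exists_compact_between hΩ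
    (isOpen_iUnion fun i : t => Metric.isOpen_ball) hcov
  obtain ⟨χ, hχ⟩ := SmoothPartitionOfUnity.exists_isSubordinate
    (modelWithCornersSelf ℝ (Spacetime d)) hK.isClosed (fun i : t => Metric.ball (i : Spacetime d) (R i))
    (fun i => Metric.isOpen_ball) hKb
  have hχs : ∀ i : t, tsupport (χ i) ⊆ Metric.ball (i : Spacetime d) (R i) := hχ
  have hχc : ∀ i : t, ContDiff ℝ 1 (χ i) := fun i =>
    (χ i).contMDiff.contDiff.of_le (by exact_mod_cast le_top)
  set F : t → Spacetime d → ℝ := fun i y => χ i y * f y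
  have hFs : ∀ i : t, tsupport (F i) ⊆ tsupport (χ i) := fun i =>
    closure_mono (Function.support_mul_subset_left _ _)
  have hFd : ∀ i : t, ContDiff ℝ 1 (F i) := fun i => by
    refine (contMDiff_of_tsupport fun y hy => ContDiffAt.contMDiffAt ?_).contDiff
    have hyV : y ∈ V := hRV i (htΩ i i.2) (hχs i (hFs i hy))
    exact (hχc i).contDiffAt.mul (hf.contDiffAt (hV.mem_nhds hyV))
  have hFc : ∀ i : t, HasCompactSupport (F i) := fun i =>
    Metric.isCompact_of_isClosed_isBounded (isClosed_tsupport _)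
      (Metric.isBounded_ball.subset ((hFs i).trans (hχs i)))
  have hFsum : ∀ y ∈ K, f y = ∑ i, F i y := fun y hy => by
    have := χ.sum_eq_one hy
    rw [finsum_eq_sum_of_fintype] at this
    rw [← Finset.sum_mul, this, one_mul]
  have hFH := fun i : t => H i (htΩ i i.2) (F i) (hFd i) (hFc i) ((hFs i).trans (hχs i))
  have hL : ∫ y in Ω, fderiv ℝ f y e = ∫ y in Ω, ∑ i, fderiv ℝ (F i) y e := by
    refine setIntegral_congr_fun hΩ.measurableSet fun y hy => ?_
    have hev : f =ᶠ[𝓝 y] fun z => ∑ i, F i z := by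
      filter_upwards [mem_interior_iff_mem_nhds.1 (hΩK hy)] with z hz using hFsum z hz
    simp only [hev.fderiv_eq]
    rw [fderiv_fun_sum fun i _ => (hFd i).differentiable one_ne_zero y,
      _root_.sum_apply]
  have hRi : ∫ y in frontier Ω, inner ℝ (outwardNormal Ω y) e * f y
      ∂(Measure.euclideanHausdorffMeasure d) =
      ∫ y in frontier Ω, ∑ i, inner ℝ (outwardNormal Ω y) e * F i y
        ∂(Measure.euclideanHausdorffMeasure d) := by
    refine setIntegral_congr_fun isClosed_frontier.measurableSet fun y hy => ?_
    simp only [hFsum y (interior_subset (hΩK (hΩ.isClosed.frontier_subset hy))), Finset.mul_sum]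
  rw [hL, hRi, integral_finsetSum, integral_finsetSum]
  · exact Finset.sum_congr rfl fun i _ => hFH i
  · exact fun i _ => integrableOn_frontier hΩ hs
      (((continuousOn_outwardNormal hΩ.isClosed hs).inner continuousOn_const).mul
        (hFd i).continuous.continuousOn)
  · exact fun i _ => (((hFd i).continuous_fderiv one_ne_zero).clm_apply
      continuous_const).continuousOn.integrableOn_compact hΩ

end Divergence

section Variation

variable {d : ℕ} {F : Type*} [NormedAddCommGroup F] [NormedSpace ℝ F]

/-- Differentiation of functions of `(x, φ, ∂φ)` in the argument `φ`. -/
noncomputable def fieldIncl (d : ℕ) (F : Type*) [NormedAddCommGroup F] [NormedSpace ℝ F] :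
    F →L[ℝ] Spacetime d × F × (Fin (d + 1) → F) :=
  (ContinuousLinearMap.inr ℝ (Spacetime d) (F × (Fin (d + 1) → F))).comp
    (ContinuousLinearMap.inl ℝ F (Fin (d + 1) → F))

/-- Differentiation of functions of `(x, φ, ∂φ)` in the argument `∂_μ φ`. -/
noncomputable def momentumIncl (F : Type*) [NormedAddCommGroup F] [NormedSpace ℝ F]
    (μ : Fin (d + 1)) : F →L[ℝ] Spacetime d × F × (Fin (d + 1) → F) :=
  (ContinuousLinearMap.inr ℝ (Spacetime d) (F × (Fin (d + 1) → F))).comp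
    ((ContinuousLinearMap.inr ℝ F (Fin (d + 1) → F)).comp
      (ContinuousLinearMap.single ℝ (fun _ : Fin (d + 1) => F) μ))

theorem fieldIncl_add_sum_momentumIncl (u : F) (p : Fin (d + 1) → F) :
    fieldIncl d F u + ∑ μ, momentumIncl F μ (p μ) = (0, u, p) := by
  have : ∑ μ, momentumIncl F μ (p μ) = ((0, 0, p) : Spacetime d × F × (Fin (d + 1) → F)) := by
    simp only [momentumIncl, ContinuousLinearMap.comp_apply, ← map_sum]
    simp [Finset.univ_sum_single]
  rw [this]
  simp [fieldIncl]

variable {L : Spacetime d × F × (Fin (d + 1) → F) → ℝ} {φ : Spacetime d → F} {x : Spacetime d}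

theorem fieldDeriv_eq (hL : DifferentiableAt ℝ L (jet φ x)) :
    fieldDeriv L φ x = (fderiv ℝ L (jet φ x)).comp (fieldIncl d F) := by
  have h2 : HasFDerivAt (fun u : F => ((x, u, fun μ => partialDeriv μ φ x) :
      Spacetime d × F × (Fin (d + 1) → F))) (fieldIncl d F) (φ x) :=
    ((hasFDerivAt_const x (φ x)).prodMk ((hasFDerivAt_id (φ x)).prodMk
      (hasFDerivAt_const (fun μ => partialDeriv μ φ x) (φ x)))).congr_fderiv rfl
  exact (hL.hasFDerivAt.comp (φ x) h2).fderiv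

theorem momentum_eq (hL : DifferentiableAt ℝ L (jet φ x)) (μ : Fin (d + 1)) :
    momentum L φ μ x = (fderiv ℝ L (jet φ x)).comp (momentumIncl F μ) := by
  have h1 : HasFDerivAt L (fderiv ℝ L (jet φ x)) (x, φ x, Function.update
      (fun ν => partialDeriv ν φ x) μ (partialDeriv μ φ x)) := by
    rw [Function.update_eq_self]
    exact hL.hasFDerivAt
  have h2 : HasFDerivAt (fun v : F => ((x, φ x, Function.update (fun ν => partialDeriv ν φ x) μ v) :
      Spacetime d × F × (Fin (d + 1) → F))) (momentumIncl F μ) (partialDeriv μ φ x) := by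
    have h3 := (hasFDerivAt_const x (partialDeriv μ φ x)).prodMk
      ((hasFDerivAt_const (φ x) (partialDeriv μ φ x)).prodMk
        (hasFDerivAt_update (𝕜 := ℝ) (fun ν => partialDeriv ν φ x) (i := μ) (partialDeriv μ φ x)))
    refine h3.congr_fderiv (ContinuousLinearMap.ext fun v => ?_)
    refine Prod.ext rfl (Prod.ext rfl (funext fun ν => ?_))
    by_cases hν : ν = μ
    · subst hν; simp [momentumIncl]
    · simp [momentumIncl, hν]
  exact (h1.comp (partialDeriv μ φ x) h2).fderiv

theorem contDiffOn_partialDeriv {G : Type*} [NormedAddCommGroup G] [NormedSpace ℝ G]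
    {f : Spacetime d → G} {W : Set (Spacetime d)} (hW : IsOpen W) (hf : ContDiffOn ℝ ∞ f W)
    (μ : Fin (d + 1)) : ContDiffOn ℝ ∞ (partialDeriv μ f) W :=
  (hf.fderiv_of_isOpen hW (m := ∞) (by simp)).clm_apply contDiffOn_const

theorem contDiffOn_jet {W : Set (Spacetime d)} (hW : IsOpen W) (hφ : ContDiffOn ℝ ∞ φ W) :
    ContDiffOn ℝ ∞ (jet φ) W :=
  contDiffOn_id.prodMk (hφ.prodMk (contDiffOn_pi.2 fun μ => contDiffOn_partialDeriv hW hφ μ))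

theorem contDiffOn_momentum {W : Set (Spacetime d)} (hW : IsOpen W)
    (hL : ContDiffOn ℝ ∞ L (W ×ˢ univ)) (hφ : ContDiffOn ℝ ∞ φ W) (μ : Fin (d + 1)) :
    ContDiffOn ℝ ∞ (momentum L φ μ) W := by
  have hWo : IsOpen (W ×ˢ (univ : Set (F × (Fin (d + 1) → F)))) := hW.prod isOpen_univ
  have h1 : ContDiffOn ℝ ∞ (fun x => fderiv ℝ L (jet φ x)) W :=
    (hL.fderiv_of_isOpen hWo (m := ∞) (by simp)).comp (contDiffOn_jet hW hφ)
      fun x hx => ⟨hx, mem_univ _⟩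
  refine (h1.clm_comp contDiffOn_const).congr fun x hx => momentum_eq ?_ μ
  exact (hL.contDiffAt (hWo.mem_nhds ⟨hx, mem_univ _⟩)).differentiableAt (by simp)

variable {Φ : ℝ → Spacetime d → F} {δ : ℝ} {W : Set (Spacetime d)}

/-- The first variation `∂φ_ε/∂ε` at `ε = 0`. -/
noncomputable def firstVariation (Φ : ℝ → Spacetime d → F) (x : Spacetime d) : F :=
  deriv (fun ε => Φ ε x) 0

theorem isOpen_perturbationDomain (hW : IsOpen W) : IsOpen (Ioo (-δ) δ ×ˢ W) :=
  isOpen_Ioo.prod hW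

theorem hasDerivAt_perturbation (hδ : 0 < δ) (hW : IsOpen W)
    (hΦ : ContDiffOn ℝ ∞ (fun q : ℝ × Spacetime d => Φ q.1 q.2) (Ioo (-δ) δ ×ˢ W)) (hx : x ∈ W) :
    HasDerivAt (fun ε => Φ ε x)
      (fderiv ℝ (fun q : ℝ × Spacetime d => Φ q.1 q.2) (0, x) (1, 0)) 0 := by
  have h1 := ((hΦ.contDiffAt ((isOpen_perturbationDomain hW).mem_nhds
    (⟨⟨by simpa, hδ⟩, hx⟩ : ((0 : ℝ), x) ∈ Ioo (-δ) δ ×ˢ W))).differentiableAt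
      (by simp)).hasFDerivAt
  exact h1.comp_hasDerivAt (0 : ℝ) ((hasDerivAt_id (0 : ℝ)).prodMk (hasDerivAt_const (0 : ℝ) x))

theorem contDiffOn_firstVariation (hδ : 0 < δ) (hW : IsOpen W)
    (hΦ : ContDiffOn ℝ ∞ (fun q : ℝ × Spacetime d => Φ q.1 q.2) (Ioo (-δ) δ ×ˢ W)) :
    ContDiffOn ℝ ∞ (firstVariation Φ) W := by
  have h1 : ContDiffOn ℝ ∞
      (fun x => fderiv ℝ (fun q : ℝ × Spacetime d => Φ q.1 q.2) (0, x)) W :=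
    (hΦ.fderiv_of_isOpen (isOpen_perturbationDomain hW) (m := ∞) (by simp)).comp
      (contDiffOn_const.prodMk contDiffOn_id) fun x hx => ⟨⟨by simpa, hδ⟩, hx⟩
  exact (h1.clm_apply contDiffOn_const).congr fun x hx =>
    (hasDerivAt_perturbation hδ hW hΦ hx).deriv

/-- The variation commutes with the partial derivatives. -/
theorem hasDerivAt_partialDeriv_perturbation (hδ : 0 < δ) (hW : IsOpen W)
    (hΦ : ContDiffOn ℝ ∞ (fun q : ℝ × Spacetime d => Φ q.1 q.2) (Ioo (-δ) δ ×ˢ W)) (hx : x ∈ W)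
    (μ : Fin (d + 1)) :
    HasDerivAt (fun ε => partialDeriv μ (Φ ε) x) (partialDeriv μ (firstVariation Φ) x) 0 := by
  set f : ℝ × Spacetime d → F := fun q => Φ q.1 q.2
  set e : Spacetime d := EuclideanSpace.single μ (1 : ℝ)
  have hopen := isOpen_perturbationDomain (δ := δ) hW
  have h0 : ((0 : ℝ), x) ∈ Ioo (-δ) δ ×ˢ W := ⟨⟨by simpa, hδ⟩, hx⟩
  have hf0 := hΦ.contDiffAt (hopen.mem_nhds h0)
  have hdf : HasFDerivAt (fderiv ℝ f) (fderiv ℝ (fderiv ℝ f) (0, x)) (0, x) :=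
    ((hf0.fderiv_right (m := ∞) (by simp)).differentiableAt (by simp)).hasFDerivAt
  have hsymm : IsSymmSndFDerivAt ℝ f (0, x) :=
    hf0.isSymmSndFDerivAt (by
      rw [minSmoothness_of_isRCLikeNormedField]; exact WithTop.coe_le_coe.2 le_top)
  have h1 : HasDerivAt (fun ε : ℝ => fderiv ℝ f (ε, x) (0, e))
      (fderiv ℝ (fderiv ℝ f) (0, x) (1, 0) (0, e)) 0 := by
    have := hdf.comp_hasDerivAt (0 : ℝ)
      ((hasDerivAt_id (0 : ℝ)).prodMk (hasDerivAt_const (0 : ℝ) x))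
    exact this.clm_apply (hasDerivAt_const _ _) |>.congr_deriv (by simp)
  have h2 : HasFDerivAt (fun y : Spacetime d => fderiv ℝ f (0, y) (1, 0))
      ((fderiv ℝ (fderiv ℝ f) (0, x)).flip (1, 0) ∘L ContinuousLinearMap.inr ℝ ℝ (Spacetime d))
      x := by
    have h3 : HasFDerivAt (fun y : Spacetime d => ((0 : ℝ), y))
        (ContinuousLinearMap.inr ℝ ℝ (Spacetime d)) x :=
      (hasFDerivAt_const _ _).prodMk (hasFDerivAt_id _)
    have := hdf.comp x h3
    refine (this.clm_apply (hasFDerivAt_const ((1, 0) : ℝ × Spacetime d) x)).congr_fderiv ?_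
    ext v
    simp
  have h4 : firstVariation Φ =ᶠ[𝓝 x] fun y => fderiv ℝ f (0, y) (1, 0) := by
    filter_upwards [hW.mem_nhds hx] with y hy
      using (hasDerivAt_perturbation hδ hW hΦ hy).deriv
  have h5 : (fun ε => partialDeriv μ (Φ ε) x) =ᶠ[𝓝 0] fun ε => fderiv ℝ f (ε, x) (0, e) := by
    filter_upwards [isOpen_Ioo.mem_nhds h0.1] with ε hε
    have h6 := ((hΦ.contDiffAt (hopen.mem_nhds
      (⟨hε, hx⟩ : (ε, x) ∈ Ioo (-δ) δ ×ˢ W))).differentiableAt (by simp)).hasFDerivAt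
    have h7 : HasFDerivAt (fun y : Spacetime d => (ε, y))
        (ContinuousLinearMap.inr ℝ ℝ (Spacetime d)) x :=
      (hasFDerivAt_const _ _).prodMk (hasFDerivAt_id _)
    have h8 : fderiv ℝ (Φ ε) x = _ := (h6.comp x h7).fderiv
    simp [partialDeriv, h8, e, f]
  refine (h1.congr_of_eventuallyEq h5).congr_deriv ?_
  rw [partialDeriv, h4.fderiv_eq, h2.fderiv]
  simpa using hsymm (1, 0) (0, e)

theorem hasDerivAt_jet_perturbation (hδ : 0 < δ) (hW : IsOpen W)
    (hΦ : ContDiffOn ℝ ∞ (fun q : ℝ × Spacetime d => Φ q.1 q.2) (Ioo (-δ) δ ×ˢ W)) (hx : x ∈ W) :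
    HasDerivAt (fun ε => jet (Φ ε) x)
      (0, firstVariation Φ x, fun μ => partialDeriv μ (firstVariation Φ) x) 0 :=
  (hasDerivAt_const _ _).prodMk
    (((hasDerivAt_perturbation hδ hW hΦ hx).differentiableAt.hasDerivAt).prodMk
      (hasDerivAt_pi.2 fun μ => hasDerivAt_partialDeriv_perturbation hδ hW hΦ hx μ))

theorem jet_congr {φ ψ : Spacetime d → F} (h : φ =ᶠ[𝓝 x] ψ) : jet φ x = jet ψ x := by
  simp only [jet, partialDeriv, h.eq_of_nhds, h.fderiv_eq]

/-- The first variation of the Lagrangian density. -/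
theorem variationDensity_eq (hδ : 0 < δ) (hW : IsOpen W)
    (hL : DifferentiableAt ℝ L (jet φ x))
    (hΦ : ContDiffOn ℝ ∞ (fun q : ℝ × Spacetime d => Φ q.1 q.2) (Ioo (-δ) δ ×ˢ W)) (hx : x ∈ W)
    (hφ : Φ 0 =ᶠ[𝓝 x] φ) :
    variationDensity L Φ x = fieldDeriv L φ x (firstVariation Φ x) +
      ∑ μ, momentum L φ μ x (partialDeriv μ (firstVariation Φ) x) := by
  have h1 : HasFDerivAt L (fderiv ℝ L (jet φ x)) (jet (Φ 0) x) := by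
    rw [jet_congr hφ]
    exact hL.hasFDerivAt
  have h2 : variationDensity L Φ x = _ :=
    (h1.comp_hasDerivAt (0 : ℝ) (hasDerivAt_jet_perturbation hδ hW hΦ hx)).deriv
  rw [h2, ← fieldIncl_add_sum_momentumIncl, map_add, map_sum, fieldDeriv_eq hL]
  simp only [momentum_eq hL]
  rfl

/-- The divergence of the current `(δL/δ(∂_μ φ)) ∂φ_ε/∂ε|₀` of a solution is the variation of the
Lagrangian density. -/
theorem divergence_current_eq {η : Spacetime d → F}
    (hp : ∀ μ, DifferentiableAt ℝ (momentum L φ μ) x) (hη : DifferentiableAt ℝ η x)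
    (hEL : fieldDeriv L φ x - ∑ μ, partialDeriv μ (momentum L φ μ) x = 0) :
    ∑ μ, fderiv ℝ (fun y => momentum L φ μ y (η y)) x (EuclideanSpace.single μ (1 : ℝ)) =
      fieldDeriv L φ x (η x) + ∑ μ, momentum L φ μ x (partialDeriv μ η x) := by
  rw [sub_eq_zero.1 hEL, _root_.sum_apply, ← Finset.sum_add_distrib]
  refine Finset.sum_congr rfl fun μ _ => ?_
  rw [((hp μ).hasFDerivAt.clm_apply hη.hasFDerivAt).fderiv]
  simp [partialDeriv, add_comm]

end Variation

end FieldTheory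

theorem theorem2p2 {d : ℕ} {F : Type*} [NormedAddCommGroup F] [NormedSpace ℝ F]
    [FiniteDimensional ℝ F]
    (Ω : Set (FieldTheory.Spacetime d)) (hΩc : IsCompact Ω)
    (hΩs : FieldTheory.HasSmoothBoundary Ω)
    (L : FieldTheory.Spacetime d × F × (Fin (d + 1) → F) → ℝ)
    (hL : FieldTheory.IsLagrangianDensity Ω L)
    (φ : FieldTheory.Spacetime d → F) (hφ : FieldTheory.IsSolution Ω L φ)
    (Φ : ℝ → FieldTheory.Spacetime d → F) (hΦ : FieldTheory.IsPerturbedField Ω φ Φ) :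
    IntegrableOn (FieldTheory.fluxDensity Ω L φ Φ) (frontier Ω)
        (Measure.euclideanHausdorffMeasure d) ∧
      IntegrableOn (FieldTheory.variationDensity L Φ) Ω volume ∧
      FieldTheory.nonlocalConstant Ω L φ Φ = 0 := by
  open FieldTheory in
  obtain ⟨V, hVo, hΩV, hLV⟩ := hL
  obtain ⟨⟨U, hUo, hΩU, hφU⟩, hEL⟩ := hφ
  obtain ⟨⟨δ, hδ, U', hUo', hΩU', hΦU'⟩, hΦ0⟩ := hΦ
  set W := V ∩ (U ∩ U')
  have hW : IsOpen W := hVo.inter (hUo.inter hUo')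
  have hΩW : Ω ⊆ W := fun x hx => ⟨hΩV hx, hΩU hx, hΩU' hx⟩
  have hLW : ContDiffOn ℝ ∞ L (W ×ˢ univ) := hLV.mono (prod_mono inter_subset_left subset_rfl)
  have hφW : ContDiffOn ℝ ∞ φ W := hφU.mono fun x hx => hx.2.1
  have hΦW := hΦU'.mono (prod_mono_right (s := Ioo (-δ) δ) fun x (hx : x ∈ W) => hx.2.2)
  have hη := contDiffOn_firstVariation hδ hW hΦW
  have hp := fun μ => contDiffOn_momentum hW hLW hφW μ
  set J : Fin (d + 1) → Spacetime d → ℝ := fun μ y => momentum L φ μ y (firstVariation Φ y)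
  have hJW : ∀ μ, ContDiffOn ℝ 1 (J μ) W := fun μ =>
    ((hp μ).clm_apply hη).of_le (by exact_mod_cast le_top)
  have hnc : ∀ μ, ContinuousOn (fun y => outwardNormal Ω y μ) (frontier Ω) := fun μ =>
    (by fun_prop : Continuous fun y : Spacetime d => y μ).comp_continuousOn
      (continuousOn_outwardNormal hΩc.isClosed hΩs)
  have hfrW : frontier Ω ⊆ W := hΩc.isClosed.frontier_subset.trans hΩW
  have hflux : ∀ μ, IntegrableOn (fun y => outwardNormal Ω y μ * J μ y) (frontier Ω)
      (Measure.euclideanHausdorffMeasure d) := fun μ =>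
    integrableOn_frontier hΩc hΩs ((hnc μ).mul ((hJW μ).continuousOn.mono hfrW))
  have hdiv : ∀ μ, IntegrableOn (fun y => fderiv ℝ (J μ) y (EuclideanSpace.single μ (1 : ℝ))) Ω :=
    fun μ => ((((hJW μ).continuousOn_fderiv_of_isOpen hW le_rfl).clm_apply
      continuousOn_const).mono hΩW).integrableOn_compact hΩc
  have hvar : ∀ᵐ y ∂(volume.restrict Ω), variationDensity L Φ y =
      ∑ μ, fderiv ℝ (J μ) y (EuclideanSpace.single μ (1 : ℝ)) := by
    have hfr0 : ∀ᵐ y ∂(volume.restrict Ω), y ∉ frontier Ω :=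
      ae_restrict_of_ae (measure_eq_zero_iff_ae_notMem.1 (volume_frontier_eq_zero hΩc hΩs))
    filter_upwards [hfr0, ae_restrict_mem hΩc.measurableSet] with y hyf hy
    have hyi : y ∈ interior Ω := by
      by_contra hn
      exact hyf (hΩc.isClosed.frontier_eq ▸ ⟨hy, hn⟩)
    have hyW := hW.mem_nhds (hΩW hy)
    have hLy : DifferentiableAt ℝ L (jet φ y) :=
      (hLW.contDiffAt ((hW.prod isOpen_univ).mem_nhds
        (⟨hΩW hy, mem_univ _⟩ : jet φ y ∈ W ×ˢ univ))).differentiableAt (by simp)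
    have hΦy : Φ 0 =ᶠ[𝓝 y] φ := by
      filter_upwards [mem_interior_iff_mem_nhds.1 hyi] with z hz using hΦ0 z hz
    rw [variationDensity_eq hδ hW hLy hΦW (hΩW hy) hΦy]
    exact (divergence_current_eq
      (fun μ => ((hp μ).contDiffAt hyW).differentiableAt (by simp))
      ((hη.contDiffAt hyW).differentiableAt (by simp)) (hEL y hy)).symm
  refine ⟨integrable_finsetSum _ fun μ _ => hflux μ,
    (integrable_finsetSum _ fun μ _ => hdiv μ).congr (hvar.mono fun y hy => hy.symm), ?_⟩
  rw [nonlocalConstant, integral_congr_ae hvar, integral_finsetSum _ fun μ _ => hdiv μ]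
  change (∫ x in frontier Ω, ∑ μ, outwardNormal Ω x μ * J μ x
    ∂(Measure.euclideanHausdorffMeasure d)) - _ = 0
  rw [integral_finsetSum _ fun μ _ => hflux μ, sub_eq_zero]
  refine Finset.sum_congr rfl fun μ _ => ?_
  rw [integral_fderiv_eq_integral_frontier hΩc hΩs hW hΩW (hJW μ)]
  simp [EuclideanSpace.inner_single_right]
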